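/- Let $\bar M$ be a monster model of a complete first-order theory in a language $L$: for some uncountable strong limit cardinal $\kappa>|L|$, $\bar M$ is $\kappa$-saturated and strongly $\kappa$-homogeneous; "small" means of cardinality $<\kappa$. Elements, tuples (always finite), sets of parameters and definable sets are taken in $\bar M^{eq}$; definable means definable with parameters, and a definable set is a subset of a finite product of sorts. For an elementary submodel $M\preceq\bar M$, parameters and types "over $M$" are understood in $M^{eq}$. Conventions. Let $A$ be a small set and $X$ a definable set. - The $A$-conjugates of $X$ are its images under $\mathrm{Aut}(\bar M/A)$. $X$ is *almost over* $A$ if it has only finitely many $A$-conjugates. $X$ is *weakly normal relative to* $A$ if $X\ne\emptyset$ and every $x\in X$ lies in only finitely many $A$-conjugates of $X$. - $X$ *divides over* $A$ if there are a sequence $(X_i)_{i<\omega}$ of $A$-conjugates of $X$ and $k>0$ such that any $k$ terms of the sequence (with distinct indices) have empty intersection. $X$ *forks over* $A$ if it is covered by finitely many definable sets, each dividing over $A$. - For an $L^{eq}$-formula $\varphi(x,y)$ and a tuple $b$, the formula $\varphi(x,b)$ *thorn divides over* $C$ if there is a finite tuple $d$ such that $b\notin\mathrm{acl}(C,d)$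 and, for some $k>0$, the family of all $\varphi(x,b')$, with $b'$ ranging over the conjugates of $b$ under $\mathrm{Aut}(\bar M/C,d)$, is $k$-inconsistent (any $k$ instances with distinct $b'$ are jointly inconsistent). - For $C\subseteq B$ small, $\mathrm{tp}(a/B)$ *does not thorn fork over* $C$ if for every small $\hat B\supseteq B$ it has an extension $\mathrm{tp}(a'/\hat B)$ containing no formula $\varphi(x,b)$, $b\in\hat B$, that thorn divides over $C$. - "$|C|^+$-saturated" means $\mu$-saturated with $\mu=\max(\aleph_0,|C|^+)$, i.e. $\aleph_0$-saturated when $C$ is finite. **Proposition 3.1.** Let $a$ be a tuple and $C\subseteq B$ small sets. Then $\mathrm{tp}(a/B)$ does not thorn fork over $C$ if and only if there are a small $|C|^+$-saturated $M\preceq\bar M$ with $B\subseteq M$ and a complete type $p(x)$ over $M$ extending $\mathrm{tp}(a/B)$ such that, whenever $X$ is a definable set in $p$, $C\subseteq C'\subseteq M$, and $X$ is weakly normal relative to $C'$, then $X$ is almost over $C'$. Moreover, for every small set $C'$ and every definable set $X$ (in the sorts of $x$) which is weakly normal relative to $C'$: $X$ is almost over $C'$ if and only if $X$ does not divide over $C'$;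 if $X$ does not fork over $C'$, then $X$ is almost over $C'$; and if no nonempty $C'$-definable set (in the sorts of $x$) forks over $C'$, then $X$ is almost over $C'$ if and only if $X$ does not fork over $C'$. -/

import Mathlib

open FirstOrder Cardinal

universe u v w

namespace ThornForking

section Structure

variable (L : FirstOrder.Language.{u, v}) (N : Type w) [L.Structure N]

/-- `N` is `μ`-saturated: every finitely satisfiable set of formulas, in finitely many variables
and with parameters from a subset of `N` of cardinality less than `μ`, is realized in `N`. -/
def IsSaturated (μ : Cardinal.{w}) : Prop :=
  ∀ A : Set N, #A < μ → ∀ (n : ℕ) (Γ : Set (L[[A]].Formula (Fin n))),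
    (∀ Γ₀ : Finset (L[[A]].Formula (Fin n)), (Γ₀ : Set (L[[A]].Formula (Fin n))) ⊆ Γ →
      ∃ x : Fin n → N, ∀ φ ∈ Γ₀, φ.Realize x) →
    ∃ x : Fin n → N, ∀ φ ∈ Γ, φ.Realize x

/-- `N` is strongly `κ`-homogeneous: every partial elementary map whose domain has cardinality
less than `κ` extends to an automorphism of `N`. -/
def IsStronglyHomogeneous (κ : Cardinal.{w}) : Prop :=
  ∀ A : Set N, #A < κ → ∀ f : A → N,
    (∀ φ : L.Formula A, φ.Realize (fun a : A => (a : N)) ↔ φ.Realize f) →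
    ∃ σ : N ≃[L] N, ∀ a : A, σ a = f a

/-- `N` is a monster model with respect to the cardinal `κ`: "small" means of cardinality less
than `κ`. The cardinal `κ` is an uncountable strong limit, larger than the cardinality of the
language. -/
structure IsMonster (κ : Cardinal.{w}) : Prop where
  aleph0_lt : ℵ₀ < κ
  isStrongLimit : κ.IsStrongLimit
  card_lt : Cardinal.lift.{w} L.card < Cardinal.lift.{max u v} κ
  saturated : IsSaturated L N κ
  homogeneous : IsStronglyHomogeneous L N κ

/-- A sort of `N^eq`: an equivalence relation on a finite power `N ^ n` which is definable
without parameters. -/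
structure EqSort where
  arity : ℕ
  rel : Setoid (Fin arity → N)
  definable : (∅ : Set N).Definable L
    {v : Fin arity ⊕ Fin arity → N | rel (fun i => v (Sum.inl i)) (fun i => v (Sum.inr i))}

end Structure

variable {L : FirstOrder.Language.{u, v}} {N : Type w} [L.Structure N]

/-- The set of elements of `N^eq` of a given sort. -/
def EqSort.Carrier (S : EqSort L N) : Type w := Quotient S.rel

/-- The class of a real tuple. -/
def EqSort.cls (S : EqSort L N) (v : Fin S.arity → N) : S.Carrier := Quotient.mk S.rel v

theorem EqSort.rel_map (S : EqSort L N) (σ : N ≃[L] N) (v w : Fin S.arity → N)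
    (h : S.rel v w) : S.rel (σ ∘ v) (σ ∘ w) := by
  obtain ⟨φ, hφ⟩ := Set.empty_definable_iff.1 S.definable
  have key : ∀ x y : Fin S.arity → N, S.rel x y ↔ φ.Realize (Sum.elim x y) := by
    intro x y
    have := Set.ext_iff.1 hφ (Sum.elim x y)
    exact this
  rw [key] at h ⊢
  rw [← Sum.comp_elim]
  exact (FirstOrder.Language.StrongHomClass.realize_formula σ φ).2 h

/-- The action of an automorphism of `N` on a sort of `N^eq`. -/
def EqSort.map (S : EqSort L N) (σ : N ≃[L] N) : S.Carrier → S.Carrier :=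
  Quotient.map (fun v => σ ∘ v) (fun v w h => S.rel_map σ v w h)

variable (L N) in
/-- The set of elements of `N^eq` (of all sorts). -/
def Imag : Type w := Σ S : EqSort L N, S.Carrier

/-- The action of an automorphism of `N` on `N^eq`. -/
def Imag.map (σ : N ≃[L] N) (e : Imag L N) : Imag L N := ⟨e.1, e.1.map σ e.2⟩

/-- Finite tuples of elements of `N^eq`, of a given tuple of sorts. -/
def Tuple {n : ℕ} (s : Fin n → EqSort L N) : Type w := ∀ i, (s i).Carrier

section Tuples

variable {m n : ℕ} {s : Fin m → EqSort L N} {t : Fin n → EqSort L N}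

/-- The set of coordinates of a tuple. -/
def Tuple.coords (a : Tuple s) : Set (Imag L N) := Set.range fun i => (⟨s i, a i⟩ : Imag L N)

/-- The action of an automorphism of `N` on tuples from `N^eq`. -/
def Tuple.map (σ : N ≃[L] N) (a : Tuple s) : Tuple s := fun i => (s i).map σ (a i)

variable (s) in
/-- The real variables standing for representatives of a tuple of variables of sorts `s`. -/
abbrev RealVars : Type := Σ i : Fin m, Fin (s i).arity

variable (s) in
/-- The tuple from `N^eq` represented by a tuple of real elements. -/
def Tuple.mk (v : RealVars s → N) : Tuple s := fun i => (s i).cls fun j => v ⟨i, j⟩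

/-- The relation `R(x, y)` on `N^eq` is definable without parameters. The structure of `N^eq` is
the one induced by `N`: a relation between sorts is definable without parameters when its
preimage, a relation on representatives, is definable without parameters in `N`. Such an `R` plays
the role of a formula `φ(x, y)` of `N^eq`, with its variables partitioned. -/
def ZeroDefinable (R : Set (Tuple s × Tuple t)) : Prop :=
  (∅ : Set N).Definable L {v : RealVars s ⊕ RealVars t → N |
    (Tuple.mk s (fun i => v (Sum.inl i)), Tuple.mk t (fun j => v (Sum.inr j))) ∈ R}

/-- The set defined by `φ(x, b)`, where `R` is the relation defined by `φ(x, y)`. -/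
def fiber (R : Set (Tuple s × Tuple t)) (b : Tuple t) : Set (Tuple s) := {x | (x, b) ∈ R}

/-- `X` is definable in `N^eq` with parameters from `A`. -/
def DefinableOver (A : Set (Imag L N)) (X : Set (Tuple s)) : Prop :=
  ∃ (l : ℕ) (r : Fin l → EqSort L N) (c : Tuple r) (R : Set (Tuple s × Tuple r)),
    c.coords ⊆ A ∧ ZeroDefinable R ∧ X = fiber R c

theorem DefinableOver.compl {A : Set (Imag L N)} {X : Set (Tuple s)} (h : DefinableOver A X) :
    DefinableOver A Xᶜ := by
  obtain ⟨l, r, c, R, hc, hR, rfl⟩ := h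
  exact ⟨l, r, c, Rᶜ, hc, Set.Definable.compl hR, rfl⟩

/-- `X` is definable in `N^eq`, with arbitrary parameters. -/
def IsDefinable (X : Set (Tuple s)) : Prop := DefinableOver Set.univ X

/-- The algebraic closure of `A` in `N^eq`: the elements of finite `A`-definable sets. -/
def acl (A : Set (Imag L N)) : Set (Imag L N) :=
  {e | ∃ X : Set (Tuple (fun _ : Fin 1 => e.1)),
    DefinableOver A X ∧ X.Finite ∧ (fun _ => e.2) ∈ X}

/-- The automorphism `σ` fixes `A` pointwise. -/
def Fixes (σ : N ≃[L] N) (A : Set (Imag L N)) : Prop := ∀ e ∈ A, e.map σ = e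

/-- The conjugates of the set `X` under the automorphisms fixing `A` pointwise. -/
def conjugates (A : Set (Imag L N)) (X : Set (Tuple s)) : Set (Set (Tuple s)) :=
  {Y | ∃ σ : N ≃[L] N, Fixes σ A ∧ Y = Tuple.map σ '' X}

/-- `X` is almost over `A`: it has finitely many conjugates over `A`. -/
def AlmostOver (A : Set (Imag L N)) (X : Set (Tuple s)) : Prop := (conjugates A X).Finite

/-- The set `X` is weakly normal relative to `A`: it is nonempty, and each of its elements belongs
to only finitely many conjugates of `X` over `A`. -/
def WeaklyNormal (A : Set (Imag L N)) (X : Set (Tuple s)) : Prop :=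
  X.Nonempty ∧ ∀ x ∈ X, {Y ∈ conjugates A X | x ∈ Y}.Finite

/-- The definable set `X` divides over `A`: there are a sequence of conjugates of `X` over `A`
(equivalently of instances `φ(x, bᵢ)` with `bᵢ` a conjugate of `b` over `A`, where `φ(x, b)`
defines `X`) and a number `k > 0` such that any `k` terms of the sequence have empty
intersection. -/
def Divides (A : Set (Imag L N)) (X : Set (Tuple s)) : Prop :=
  ∃ Y : ℕ → Set (Tuple s), (∀ i, Y i ∈ conjugates A X) ∧
    ∃ k > 0, ∀ I : Finset ℕ, I.card = k → ⋂ i ∈ I, Y i = ∅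

/-- The definable set `X` forks over `A`: it is covered by finitely many definable sets, each of
which divides over `A`. -/
def Forks (A : Set (Imag L N)) (X : Set (Tuple s)) : Prop :=
  ∃ (l : ℕ) (Z : Fin l → Set (Tuple s)),
    (∀ j, IsDefinable (Z j) ∧ Divides A (Z j)) ∧ X ⊆ ⋃ j, Z j

/-- The formula `φ(x, b)` strongly divides over `A`, where `R` is the relation defined by
`φ(x, y)`: the tuple `b` is not algebraic over `A` and, for some `k > 0`, the set of all
`φ(x, b')` with `b'` a conjugate of `b` over `A` is `k`-inconsistent. -/
def StronglyDivides (A : Set (Imag L N)) (R : Set (Tuple s × Tuple t)) (b : Tuple t) : Prop :=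
  ¬ b.coords ⊆ acl A ∧
    ∃ k > 0, ∀ b' : Fin k → Tuple t, Function.Injective b' →
      (∀ i, ∃ σ : N ≃[L] N, Fixes σ A ∧ b' i = b.map σ) → ⋂ i, fiber R (b' i) = ∅

/-- The formula `φ(x, b)` thorn divides over `C`, where `R` is the relation defined by `φ(x, y)`:
it strongly divides over `C ∪ {d}` for some finite tuple `d`. -/
def ThornDivides (C : Set (Imag L N)) (R : Set (Tuple s × Tuple t)) (b : Tuple t) : Prop :=
  ∃ (l : ℕ) (r : Fin l → EqSort L N) (d : Tuple r), StronglyDivides (C ∪ d.coords) R b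

end Tuples

variable {m : ℕ} {s : Fin m → EqSort L N}

/-- A complete type over `A ⊆ N^eq` in variables of sorts `s`, given by the `A`-definable sets
which belong to it. -/
structure CompleteType (A : Set (Imag L N)) (s : Fin m → EqSort L N) where
  sets : Set (Set (Tuple s))
  definable : ∀ X ∈ sets, DefinableOver A X
  consistent : ∀ F : Finset (Set (Tuple s)), (F : Set (Set (Tuple s))) ⊆ sets →
    (⋂ X ∈ F, X).Nonempty
  complete : ∀ X, DefinableOver A X → X ∈ sets ∨ Xᶜ ∈ sets

/-- The type `tp(a/A)`. -/
def tp (a : Tuple s) (A : Set (Imag L N)) : CompleteType A s where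
  sets := {X | DefinableOver A X ∧ a ∈ X}
  definable _ hX := hX.1
  consistent F hF := ⟨a, Set.mem_iInter₂.2 fun _ hX => (hF hX).2⟩
  complete X hX := by
    by_cases h : a ∈ X
    · exact Or.inl ⟨hX, h⟩
    · exact Or.inr ⟨hX.compl, h⟩

/-- The type `q` extends the type `p`. -/
def CompleteType.Extends {A A' : Set (Imag L N)} (q : CompleteType A' s) (p : CompleteType A s) :
    Prop := A ⊆ A' ∧ p.sets ⊆ q.sets

/-- The type `p` over `A` thorn divides over `C`: some formula `φ(x, b)` in `p`, with `b` a finite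
tuple from `A`, thorn divides over `C`. -/
def CompleteType.ThornDivides {A : Set (Imag L N)} (p : CompleteType A s)
    (C : Set (Imag L N)) : Prop :=
  ∃ (n : ℕ) (t : Fin n → EqSort L N) (b : Tuple t) (R : Set (Tuple s × Tuple t)),
    b.coords ⊆ A ∧ ZeroDefinable R ∧ fiber R b ∈ p.sets ∧ ThornForking.ThornDivides C R b

/-- The type `p` over `B` does not thorn fork over `C`: for every small `B' ⊇ B` it has an
extension `tp(a'/B')` which does not thorn divide over `C`. -/
def CompleteType.NotThornForks (κ : Cardinal.{w}) {B : Set (Imag L N)} (p : CompleteType B s)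
    (C : Set (Imag L N)) : Prop :=
  ∀ B' : Set (Imag L N), B ⊆ B' → #B' < κ →
    ∃ a' : Tuple s, (tp a' B').Extends p ∧ ¬ (tp a' B').ThornDivides C

/-- The elements of `N^eq` which belong to `M^eq`, for an elementary substructure `M` of `N`: those
which have a representative in `M`. -/
def eqPart (M : L.ElementarySubstructure N) : Set (Imag L N) :=
  {e | ∃ v : Fin e.1.arity → N, (∀ i, v i ∈ M) ∧ e.1.cls v = e.2}

end ThornForking

open ThornForking

/-!
The proof rests on three consequences of `N` being a monster model, all for parameter sets in
`N^eq`: small types are realized, even in infinitely many variables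
(`IsMonster.exists_mem_realDefinable`); real tuples with the same type over a small `A` are
conjugate over `A` (`IsMonster.exists_fixes`); and a definable set invariant under the automorphisms
over `A` is definable over `A` (`IsMonster.realDefinable_of_invariant`), so that a tuple with
finitely many conjugates over `A` is algebraic over `A`. Definability over `A ⊆ N^eq` is handled
through families of real representatives of `A` (`RealDefinable`).

The heart of the matter is a compactness argument (`IsMonster.exists_inconsistent`): if `X` is
weakly normal relative to a small `A`, then for some `k` any `k` distinct conjugates of `X` are
disjoint, and a single formula over a finite tuple `d` from `A` is responsible for this. Otherwise
some point of `X` would lie in infinitely many conjugates of `X`. Hence, if `X` is moreover not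
almost over `A`, it divides over `A`, which with a pigeonhole argument gives the statements on
dividing and forking; and a formula defining `X` from its canonical parameter `e` strongly divides
over `C ∪ d` for every `C ⊆ A`, since `e` has infinitely many conjugates over `A`
(`WeaklyNormal.exists_thornDivides`). Conversely, the set defined by a consistent formula `φ(x, b)`
which strongly divides over `A` is weakly normal relative to `A` and not almost over `A`
(`StronglyDivides.weaklyNormal_and_not_almostOver`).

If `tp(a/B)` does not thorn fork over `C`, take any small saturated `M` with `B ⊆ M^eq` and an
extension of `tp(a/B)` to `M^eq` which does not thorn divide over `C`. Conversely, suppose that `p`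
is a type over `M` as in the statement but cannot be completed over `B' ⊇ B` without thorn dividing
over `C`. Then a set `X` in `p` is covered by finitely many instances `φᵢ(x, bᵢ)` strongly dividing
over `C ∪ dᵢ`. By saturation of `M` an automorphism fixing `C` and the parameters of `X` moves all
`bᵢ` and `dᵢ` into `M`. One of the translated instances belongs to `p`, and it is weakly normal
relative to `C ∪ dᵢ` without being almost over it.
-/

namespace ThornForking

/-! ### Realizing types in a monster model -/

section ZeroDefinableSets

variable {L : FirstOrder.Language.{u, v}} {N : Type w} [L.Structure N]

variable (L) in
/-- The set `X` of assignments of elements of `N` to variables is definable without parameters. -/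
abbrev ZDef {α : Type*} (X : Set (α → N)) : Prop := (∅ : Set N).Definable L X

theorem zDef_eq {α : Type*} (a b : α) : ZDef L {v : α → N | v a = v b} := by
  refine ⟨(FirstOrder.Language.var a).equal (FirstOrder.Language.var b), ?_⟩
  ext v
  simp

theorem zDef_setOf_realize {α : Type*} (φ : L.Formula α) : ZDef L {v : α → N | φ.Realize v} :=
  Set.empty_definable_iff.2 ⟨φ, rfl⟩

theorem zDef_forall {α ι : Type*} [Finite ι] {p : ι → (α → N) → Prop}
    (h : ∀ i, ZDef L {v | p i v}) : ZDef L {v | ∀ i, p i v} := by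
  have := Set.definable_iInter_of_finite h
  rwa [← Set.ofPred_forall] at this

/-- A formula has finitely many free variables. -/
theorem ZDef.exists_support {α : Type*} {X : Set (α → N)} (hX : ZDef L X) :
    ∃ F : Finset α, ∀ v v' : α → N, (∀ a ∈ F, v a = v' a) → v ∈ X → v' ∈ X := by
  classical
  obtain ⟨φ, rfl⟩ := Set.empty_definable_iff.1 hX
  refine ⟨φ.freeVarFinset, fun v v' h hv => ?_⟩
  have h1 := FirstOrder.Language.BoundedFormula.realize_restrictFreeVar
    (φ := φ) (f := id) (v := fun a => v a) (xs := default) v (fun _ => rfl)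
  have h2 := FirstOrder.Language.BoundedFormula.realize_restrictFreeVar
    (φ := φ) (f := id) (v := fun a => v a) (xs := default) v' (fun a => h a a.2)
  exact h2.1 (h1.2 hv)

theorem ZDef.comp_mem_iff {α : Type*} {X : Set (α → N)} (hX : ZDef L X) (σ : N ≃[L] N)
    (v : α → N) : σ ∘ v ∈ X ↔ v ∈ X := by
  obtain ⟨φ, rfl⟩ := Set.empty_definable_iff.1 hX
  exact FirstOrder.Language.StrongHomClass.realize_formula σ φ

/-- Saturation, for a family of sets definable over a tuple `y` of parameters. -/
theorem IsSaturated.exists_mem {μ : Cardinal.{w}} (h : IsSaturated L N μ) {K ι : Type*}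
    [Finite ι] (y : K → N) (hy : #(Set.range y) < μ) (S : Set (Set (K ⊕ ι → N)))
    (hS : ∀ X ∈ S, ZDef L X)
    (fip : ∀ F : Set (Set (K ⊕ ι → N)), F ⊆ S → F.Finite →
      ∃ x : ι → N, ∀ X ∈ F, Sum.elim y x ∈ X) :
    ∃ x : ι → N, ∀ X ∈ S, Sum.elim y x ∈ X := by
  obtain ⟨n, ⟨e⟩⟩ := Finite.exists_equiv_fin ι
  have key : ∀ X ∈ S, ∃ ψ : L[[Set.range y]].Formula (Fin n), ∀ x : Fin n → N,
      ψ.Realize x ↔ Sum.elim y (x ∘ e) ∈ X := by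
    intro X hX
    obtain ⟨φ, rfl⟩ := Set.empty_definable_iff.1 (hS X hX)
    have hd : (Set.range y).Definable L
        {x : Fin n → N | Sum.elim y (x ∘ e) ∈ Set.ofPred φ.Realize} := by
      rw [Set.definable_iff_exists_formula_sum]
      refine ⟨φ.relabel (Sum.map (Set.rangeFactorization y) e), ?_⟩
      ext x
      simp only [FirstOrder.Language.Formula.realize_relabel, Sum.elim_comp_map]
      rfl
    obtain ⟨ψ, hψ⟩ := hd
    exact ⟨ψ, fun x => (Set.ext_iff.1 hψ x).symm⟩
  choose! ψ hψ using key
  classical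
  obtain ⟨x, hx⟩ := h (Set.range y) hy n (ψ '' S) (by
    intro Γ₀ hΓ
    obtain ⟨F, hFS, rfl⟩ := Finset.subset_set_image_iff.1 hΓ
    obtain ⟨x, hx⟩ := fip F hFS F.finite_toSet
    refine ⟨x ∘ e.symm, fun ψ' hψ' => ?_⟩
    obtain ⟨X, hX, rfl⟩ := Finset.mem_image.1 hψ'
    rw [hψ X (hFS hX)]
    simpa [Function.comp_assoc] using hx X hX)
  refine ⟨x ∘ e, fun X hX => (hψ X hX x).1 (hx _ ⟨X, hX, rfl⟩)⟩

/-- One step in the realization of a type in infinitely many variables: a partial realization,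
given by its graph `G`, extends to one more variable `i`. -/
theorem IsMonster.exists_insert {κ : Cardinal.{w}} (hN : IsMonster L N κ) {K : Type*}
    {J : Type*} (y : K → N) (S : Set (Set (K ⊕ J → N))) (hS : ∀ X ∈ S, ZDef L X)
    (G : Set (J × N)) (hG : #(Set.range y ∪ Prod.snd '' G : Set N) < κ)
    (fip : ∀ F ⊆ S, F.Finite → ∀ H ⊆ G, H.Finite →
      ∃ x : J → N, (∀ X ∈ F, Sum.elim y x ∈ X) ∧ ∀ p ∈ H, x p.1 = p.2) (i : J) :
    ∃ c : N, ∀ F ⊆ S, F.Finite → ∀ H ⊆ insert (i, c) G, H.Finite →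
      ∃ x : J → N, (∀ X ∈ F, Sum.elim y x ∈ X) ∧ ∀ p ∈ H, x p.1 = p.2 := by
  classical
  let y' : K ⊕ G → N := Sum.elim y fun p => p.1.2
  have hy' : #(Set.range y') < κ := by
    refine lt_of_le_of_lt (Cardinal.mk_le_mk_of_subset ?_) hG
    rintro _ ⟨k | p, rfl⟩
    · exact Or.inl ⟨k, rfl⟩
    · exact Or.inr ⟨p.1, p.2, rfl⟩
  -- the condition on a value `c` of the variable `i` imposed by finite sets `F` and `H`
  let Z : Set (Set (K ⊕ J → N)) → Set G → Set ((K ⊕ G) ⊕ Fin 1 → N) := fun F H =>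
    {v | ∃ x : J → N, (∀ X ∈ F, Sum.elim (fun k => v (.inl (.inl k))) x ∈ X) ∧
      (∀ p ∈ H, x p.1.1 = v (.inl (.inr p))) ∧ x i = v (.inr 0)}
  have hZ : ∀ F ⊆ S, F.Finite → ∀ H : Set G, H.Finite → ZDef L (Z F H) := by
    intro F hF hFf H hHf
    have : Finite F := hFf
    have : Finite H := hHf
    -- Only the finitely many variables in `J₀` matter; the other ones are identified with `i` by
    -- the retraction `r`, so that the existential quantifier is over a finite tuple.
    choose T hT using fun X : F => (hS X (hF X.2)).exists_support
    obtain ⟨J₀, hJ₀⟩ : ∃ J₀ : Finset J, ∀ j, (j ∈ J₀ ↔ j = i ∨ (∃ p ∈ H, p.1.1 = j) ∨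
        ∃ X : F, Sum.inr j ∈ T X) := by
      have hfin : ({i} ∪ ((fun p : G => p.1.1) '' H ∪
          ⋃ X : F, Sum.inr ⁻¹' (T X : Set (K ⊕ J)))).Finite := by
        refine (Set.finite_singleton i).union ((hHf.image _).union (Set.finite_iUnion fun X => ?_))
        exact (T X).finite_toSet.preimage Sum.inr_injective.injOn
      refine ⟨hfin.toFinset, fun j => ?_⟩
      simp [eq_comm]
    have hi : i ∈ J₀ := (hJ₀ i).2 (Or.inl rfl)
    let r : J → J₀ := fun j => if h : j ∈ J₀ then ⟨j, h⟩ else ⟨i, hi⟩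
    have hr : ∀ (j) (h : j ∈ J₀), r j = ⟨j, h⟩ := fun j h => dif_pos h
    have h1 : ∀ X : F, ZDef L {v : ((K ⊕ G) ⊕ Fin 1) ⊕ J₀ → N |
        v ∘ (Sum.elim (fun k => .inl (.inl (.inl k))) fun j => .inr (r j)) ∈ X.1} := fun X =>
      (hS X (hF X.2)).preimage_comp _
    have h2 : ∀ p : H, ZDef L {v : ((K ⊕ G) ⊕ Fin 1) ⊕ J₀ → N |
        v (.inr (r p.1.1.1)) = v (.inl (.inl (.inr p.1)))} := fun p => zDef_eq _ _
    have h3 : ZDef L {v : ((K ⊕ G) ⊕ Fin 1) ⊕ J₀ → N | v (.inr (r i)) = v (.inl (.inr 0))} :=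
      zDef_eq _ _
    have h4 := (((zDef_forall h1).inter ((zDef_forall h2).inter h3))).exists_of_finite
    convert h4 using 1
    ext v
    constructor
    · rintro ⟨x, hx1, hx2, hx3⟩
      refine ⟨fun j => x j, fun X => ?_, fun p => ?_, ?_⟩
      · refine hT X _ _ ?_ (hx1 X X.2)
        rintro (k | j) hj
        · rfl
        · have := hr j ((hJ₀ j).2 (Or.inr (Or.inr ⟨X, hj⟩)))
          simp [this]
      · have := hr p.1.1.1 ((hJ₀ _).2 (Or.inr (Or.inl ⟨p.1, p.2, rfl⟩)))
        simpa [this] using hx2 p.1 p.2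
      · simpa [hr i hi] using hx3
    · rintro ⟨x, hx1, hx2, hx3⟩
      refine ⟨x ∘ r, fun X hX => ?_, fun p hp => ?_, ?_⟩
      · convert hx1 ⟨X, hX⟩ using 1
        ext (k | j) <;> rfl
      · exact hx2 ⟨p, hp⟩
      · exact hx3
  obtain ⟨c, hc⟩ := hN.saturated.exists_mem y' hy'
    {A | ∃ F ⊆ S, F.Finite ∧ ∃ H : Set G, H.Finite ∧ A = Z F H}
    (by rintro _ ⟨F, hF, hFf, H, hHf, rfl⟩; exact hZ F hF hFf H hHf) (by
      intro Φ hΦ hΦf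
      have : Finite Φ := hΦf
      choose F hF hFf H hH hHe using fun A : Φ => hΦ A.2
      obtain ⟨x, hx1, hx2⟩ := fip (⋃ A : Φ, F A) (Set.iUnion_subset fun A => hF A)
        (Set.finite_iUnion fun A => hFf A) (⋃ A : Φ, Subtype.val '' H A)
        (Set.iUnion_subset fun A => Subtype.coe_image_subset _ _)
        (Set.finite_iUnion fun A => (hH A).image _)
      refine ⟨fun _ => x i, fun A hA => ?_⟩
      rw [show A = _ from hHe ⟨A, hA⟩]
      refine ⟨x, fun X hX => hx1 X (Set.mem_iUnion.2 ⟨⟨A, hA⟩, hX⟩), fun p hp => ?_, rfl⟩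
      exact hx2 p.1 (Set.mem_iUnion.2 ⟨⟨A, hA⟩, p, hp, rfl⟩))
  refine ⟨c 0, fun F hF hFf H hH hHf => ?_⟩
  obtain ⟨x, hx1, hx2, hx3⟩ := hc _ ⟨F, hF, hFf, Subtype.val ⁻¹' H,
    hHf.preimage Subtype.val_injective.injOn, rfl⟩
  refine ⟨x, hx1, fun p hp => ?_⟩
  rcases hH hp with rfl | hp'
  · exact hx3
  · exact hx2 ⟨p, hp'⟩ hp

/-- In a monster model, small types in a small number of variables are realized. -/
theorem IsMonster.exists_mem {κ : Cardinal.{w}} (hN : IsMonster L N κ) {K : Type*}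
    {J : Type*} (hJ : Cardinal.lift.{w} #J < Cardinal.lift κ) (y : K → N)
    (hy : #(Set.range y) < κ) (S : Set (Set (K ⊕ J → N))) (hS : ∀ X ∈ S, ZDef L X)
    (fip : ∀ F : Set (Set (K ⊕ J → N)), F ⊆ S → F.Finite →
      ∃ x : J → N, ∀ X ∈ F, Sum.elim y x ∈ X) :
    ∃ x : J → N, ∀ X ∈ S, Sum.elim y x ∈ X := by
  classical
  -- the graphs of the partial realizations
  let 𝒢 : Set (Set (J × N)) := {G | ∀ F ⊆ S, F.Finite → ∀ H ⊆ G, H.Finite →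
      ∃ x : J → N, (∀ X ∈ F, Sum.elim y x ∈ X) ∧ ∀ p ∈ H, x p.1 = p.2}
  obtain ⟨G, hG⟩ := zorn_subset 𝒢 (by
    intro c hc hchain
    rcases c.eq_empty_or_nonempty with rfl | hne
    · refine ⟨∅, fun F hF hFf H hH hHf => ?_, by simp⟩
      obtain ⟨x, hx⟩ := fip F hF hFf
      exact ⟨x, hx, fun p hp => (hH hp).elim⟩
    · refine ⟨⋃₀ c, fun F hF hFf H hH hHf => ?_, fun s hs => Set.subset_sUnion_of_mem hs⟩
      obtain ⟨t, ht, hHt⟩ :=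
        hchain.directedOn.exists_mem_subset_of_finite_of_subset_sUnion hne hHf hH
      exact hc ht F hF hFf H hHt hHf)
  have hfun : ∀ p ∈ G, ∀ q ∈ G, p.1 = q.1 → p.2 = q.2 := by
    intro p hp q hq h
    obtain ⟨x, -, hx⟩ := hG.prop ∅ (Set.empty_subset _) Set.finite_empty {p, q}
      (Set.pair_subset hp hq) (Set.toFinite _)
    rw [← hx p (by simp), ← hx q (by simp), h]
  have hcard : #(Prod.snd '' G) < κ := by
    choose f hf using fun c : Prod.snd '' G =>
      show ∃ j, (j, c.1) ∈ G by obtain ⟨_, p, hp, rfl⟩ := c; exact ⟨p.1, hp⟩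
    have hle := Cardinal.lift_mk_le_lift_mk_of_injective
      (f := fun c : Prod.snd '' G => f c) (fun c c' h =>
        Subtype.ext (hfun _ (hf c) _ (hf c') h))
    exact Cardinal.lift_lt.1 (hle.trans_lt hJ)
  have htot : ∀ i, ∃ c, (i, c) ∈ G := by
    intro i
    obtain ⟨c, hc⟩ := hN.exists_insert y S hS G
      ((Cardinal.mk_union_le _ _).trans_lt (Cardinal.add_lt_of_lt hN.aleph0_lt.le hy hcard))
      hG.prop i
    exact ⟨c, hG.le_of_ge hc (Set.subset_insert _ _) (Set.mem_insert _ _)⟩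
  choose x hx using htot
  refine ⟨x, fun X hX => ?_⟩
  obtain ⟨T, hT⟩ := (hS X hX).exists_support
  obtain ⟨x', hx', hx''⟩ := hG.prop {X} (by simpa using hX) (Set.finite_singleton _)
    ((fun j => (j, x j)) '' (Sum.inr ⁻¹' (T : Set (K ⊕ J))))
    (by rintro _ ⟨j, -, rfl⟩; exact hx j)
    ((T.finite_toSet.preimage Sum.inr_injective.injOn).image _)
  refine hT _ _ ?_ (hx' X rfl)
  rintro (k | j) hj
  · rfl
  · exact hx'' (j, x j) ⟨j, hj, rfl⟩

/-- Families of elements with the same type over the empty set are conjugate. -/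
theorem IsMonster.exists_aut {κ : Cardinal.{w}} (hN : IsMonster L N κ) {J : Type*}
    (hJ : Cardinal.lift.{w} #J < Cardinal.lift κ) (f g : J → N)
    (h : ∀ X : Set (J → N), ZDef L X → f ∈ X → g ∈ X) :
    ∃ σ : N ≃[L] N, ∀ j, σ (f j) = g j := by
  have hfg : ∀ i j, f i = f j → g i = g j := fun i j hij => h _ (zDef_eq i j) hij
  let r := Set.rangeSplitting f
  have hr : ∀ j, g (r ⟨f j, j, rfl⟩) = g j := fun j =>
    hfg _ _ (Set.apply_rangeSplitting f ⟨f j, j, rfl⟩)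
  have hle := Cardinal.mk_range_le_lift (f := f)
  obtain ⟨σ, hσ⟩ := hN.homogeneous (Set.range f) (Cardinal.lift_lt.1 (hle.trans_lt hJ)) (g ∘ r) (by
    have key : ∀ φ : L.Formula (Set.range f), φ.Realize (fun a : Set.range f => (a : N)) →
        φ.Realize (g ∘ r) := by
      intro φ hφ
      have := h _ (zDef_setOf_realize (φ.relabel r)) (by
        simp only [Set.mem_ofPred_eq, FirstOrder.Language.Formula.realize_relabel]
        convert hφ using 2
        exact Set.apply_rangeSplitting f _)
      simpa only [Set.mem_ofPred_eq, FirstOrder.Language.Formula.realize_relabel] using this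
    refine fun φ => ⟨key φ, fun hφ => ?_⟩
    by_contra hn
    exact key φ.not hn hφ)
  exact ⟨σ, fun j => (hσ ⟨f j, j, rfl⟩).trans (hr j)⟩

end ZeroDefinableSets

/-! ### The action of automorphisms on `N^eq` -/

section Action

variable {L : FirstOrder.Language.{u, v}} {N : Type w} [L.Structure N]
variable {m n : ℕ} {s : Fin m → EqSort L N} {t : Fin n → EqSort L N}

theorem Imag.map_comp (τ σ : N ≃[L] N) (e : Imag L N) :
    Imag.map (τ.comp σ) e = Imag.map τ (Imag.map σ e) := by
  obtain ⟨S, c⟩ := e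
  induction c using Quotient.inductionOn
  rfl

theorem Imag.map_symm_map (σ : N ≃[L] N) (e : Imag L N) : Imag.map σ.symm (Imag.map σ e) = e := by
  obtain ⟨S, c⟩ := e
  induction c using Quotient.inductionOn with | h v =>
  refine congrArg (fun x => (⟨S, S.cls x⟩ : Imag L N)) ?_
  ext i
  exact σ.symm_apply_apply (v i)

theorem Tuple.map_mk (σ : N ≃[L] N) (v : RealVars s → N) :
    (Tuple.mk s v).map σ = Tuple.mk s (σ ∘ v) := rfl

theorem Tuple.exists_mk (a : Tuple s) : ∃ v, Tuple.mk s v = a :=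
  ⟨fun i => (a i.1).out i.2, funext fun i => Quotient.out_eq (a i)⟩

theorem Tuple.mk_eq_mk {v v' : RealVars s → N} :
    Tuple.mk s v = Tuple.mk s v' ↔ ∀ i, (s i).rel (fun j => v ⟨i, j⟩) (fun j => v' ⟨i, j⟩) :=
  funext_iff.trans (forall_congr' fun _ => Quotient.eq)

theorem Tuple.map_comp (τ σ : N ≃[L] N) (a : Tuple s) : a.map (τ.comp σ) = (a.map σ).map τ := by
  obtain ⟨v, rfl⟩ := a.exists_mk
  rfl

theorem Tuple.map_symm_map (σ : N ≃[L] N) (a : Tuple s) : (a.map σ).map σ.symm = a := by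
  obtain ⟨v, rfl⟩ := a.exists_mk
  rw [Tuple.map_mk, Tuple.map_mk]
  congr 1
  ext i
  exact σ.symm_apply_apply (v i)

theorem Tuple.map_map_symm (σ : N ≃[L] N) (a : Tuple s) : (a.map σ.symm).map σ = a := by
  conv_rhs => rw [← Tuple.map_symm_map σ.symm a, FirstOrder.Language.Equiv.symm_symm]

theorem Tuple.map_refl (a : Tuple s) : a.map (FirstOrder.Language.Equiv.refl L N) = a := by
  obtain ⟨v, rfl⟩ := a.exists_mk
  rfl

theorem Tuple.map_injective (σ : N ≃[L] N) :
    Function.Injective (Tuple.map σ : Tuple s → Tuple s) :=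
  Function.LeftInverse.injective (Tuple.map_symm_map σ)

theorem Tuple.image_map_comp (τ σ : N ≃[L] N) (X : Set (Tuple s)) :
    Tuple.map (τ.comp σ) '' X = Tuple.map τ '' (Tuple.map σ '' X) := by
  rw [Set.image_image]
  exact Set.image_congr fun a _ => Tuple.map_comp τ σ a

theorem Tuple.image_map_symm_image (σ : N ≃[L] N) (X : Set (Tuple s)) :
    Tuple.map σ.symm '' (Tuple.map σ '' X) = X := by
  rw [Set.image_image]
  simp [Tuple.map_symm_map]

theorem Tuple.mem_image_map {σ : N ≃[L] N} {X : Set (Tuple s)} {x : Tuple s} :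
    x ∈ Tuple.map σ '' X ↔ x.map σ.symm ∈ X := by
  refine ⟨?_, fun h => ⟨_, h, Tuple.map_map_symm σ x⟩⟩
  rintro ⟨y, hy, rfl⟩
  rwa [Tuple.map_symm_map]

theorem Tuple.map_eq_self_iff {σ : N ≃[L] N} {a : Tuple s} :
    a.map σ = a ↔ Fixes σ a.coords := by
  constructor
  · rintro h _ ⟨i, rfl⟩
    exact congrArg (fun x => (⟨s i, x⟩ : Imag L N)) (congrFun h i)
  · intro h
    funext i
    exact eq_of_heq (Sigma.mk.inj (h _ ⟨i, rfl⟩)).2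

theorem Tuple.coords_map (σ : N ≃[L] N) (a : Tuple s) :
    (a.map σ).coords = Imag.map σ '' a.coords := by
  exact Set.range_comp (Imag.map σ) fun i => (⟨s i, a i⟩ : Imag L N)

theorem Fixes.mono {A B : Set (Imag L N)} {σ : N ≃[L] N} (h : Fixes σ B) (hAB : A ⊆ B) :
    Fixes σ A := fun e he => h e (hAB he)

theorem Fixes.refl (A : Set (Imag L N)) : Fixes (FirstOrder.Language.Equiv.refl L N) A := by
  rintro ⟨S, c⟩ -
  induction c using Quotient.inductionOn
  rfl

theorem Fixes.comp {A : Set (Imag L N)} {τ σ : N ≃[L] N} (hτ : Fixes τ A) (hσ : Fixes σ A) :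
    Fixes (τ.comp σ) A := fun e he => by rw [Imag.map_comp, hσ e he, hτ e he]

theorem Fixes.symm {A : Set (Imag L N)} {σ : N ≃[L] N} (h : Fixes σ A) : Fixes σ.symm A :=
  fun e he => by conv_lhs => rw [← h e he, Imag.map_symm_map]

theorem Fixes.union {A B : Set (Imag L N)} {σ : N ≃[L] N} (hA : Fixes σ A) (hB : Fixes σ B) :
    Fixes σ (A ∪ B) := fun e he => he.elim (hA e) (hB e)

end Action

/-! ### Definability over subsets of `N^eq` -/

section Definability

variable {L : FirstOrder.Language.{u, v}} {N : Type w} [L.Structure N]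
variable {m n : ℕ} {s : Fin m → EqSort L N} {t : Fin n → EqSort L N}

/-- The real variables standing for representatives of the elements of `A ⊆ N^eq`. -/
abbrev ParamVars (A : Set (Imag L N)) : Type w := Σ e : A, Fin e.1.1.arity

/-- The families of representatives of the elements of `A ⊆ N^eq`. -/
def Reps (A : Set (Imag L N)) : Set (ParamVars A → N) :=
  {y | ∀ e : A, e.1.1.cls (fun i => y ⟨e, i⟩) = e.1.2}

/-- The set `E` of real tuples is definable over `A ⊆ N^eq`: it is defined by a formula with
parameters from a family of representatives of `A`, and the choice of this family is
immaterial. -/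
def RealDefinable (A : Set (Imag L N)) {ι : Type*} (E : Set (ι → N)) : Prop :=
  ∃ X : Set (ParamVars A ⊕ ι → N), ZDef L X ∧ ∀ y ∈ Reps A, ∀ v, Sum.elim y v ∈ X ↔ v ∈ E

theorem Reps.nonempty (A : Set (Imag L N)) : (Reps A).Nonempty :=
  ⟨fun i => (i.1.1.2).out i.2, fun e => Quotient.out_eq e.1.2⟩

theorem Reps.map {A : Set (Imag L N)} {σ : N ≃[L] N} (hσ : Fixes σ A) {y : ParamVars A → N}
    (hy : y ∈ Reps A) : σ ∘ y ∈ Reps A := fun e => by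
  have h1 := hσ e e.2
  have h2 : Imag.map σ e.1 = ⟨e.1.1, e.1.1.cls (fun i => σ (y ⟨e, i⟩))⟩ := by
    rw [Imag.map, ← hy e]
    rfl
  rw [h2] at h1
  exact eq_of_heq (Sigma.mk.inj h1).2

theorem Reps.fixes {A : Set (Imag L N)} {σ : N ≃[L] N} {y : ParamVars A → N}
    (hy : y ∈ Reps A) (hy' : σ ∘ y ∈ Reps A) : Fixes σ A := fun e he => by
  have h1 := hy ⟨e, he⟩
  have h2 := hy' ⟨e, he⟩
  obtain ⟨S, c⟩ := e
  refine congrArg (fun x => (⟨S, x⟩ : Imag L N)) ?_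
  exact (congrArg (S.map σ) h1.symm).trans h2

theorem zDef_rel (S : EqSort L N) {α : Type*} (f g : Fin S.arity → α) :
    ZDef L {v : α → N | S.rel (fun i => v (f i)) (fun i => v (g i))} :=
  S.definable.preimage_comp (Sum.elim f g)

theorem zDef_mk_eq_mk {α : Type*} (f g : RealVars s → α) :
    ZDef L {v : α → N | Tuple.mk s (v ∘ f) = Tuple.mk s (v ∘ g)} := by
  simp only [Tuple.mk_eq_mk]
  exact zDef_forall fun i => zDef_rel (s i) _ _

namespace RealDefinable

variable {A B : Set (Imag L N)} {ι : Type*} {E E' : Set (ι → N)}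

theorem compl (h : RealDefinable A E) : RealDefinable A Eᶜ := by
  obtain ⟨X, hX, hE⟩ := h
  exact ⟨Xᶜ, hX.compl, fun y hy v => not_congr (hE y hy v)⟩

theorem inter (h : RealDefinable A E) (h' : RealDefinable A E') : RealDefinable A (E ∩ E') := by
  obtain ⟨X, hX, hE⟩ := h
  obtain ⟨X', hX', hE'⟩ := h'
  exact ⟨X ∩ X', hX.inter hX', fun y hy v => and_congr (hE y hy v) (hE' y hy v)⟩

theorem union (h : RealDefinable A E) (h' : RealDefinable A E') : RealDefinable A (E ∪ E') := by
  rw [← compl_compl (E ∪ E'), Set.compl_union]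
  exact (h.compl.inter h'.compl).compl

variable (A ι) in
theorem univ : RealDefinable A (Set.univ : Set (ι → N)) :=
  ⟨Set.univ, Set.definable_univ, fun _ _ _ => Iff.rfl⟩

variable (A ι) in
theorem empty : RealDefinable A (∅ : Set (ι → N)) :=
  ⟨∅, Set.definable_empty, fun _ _ _ => Iff.rfl⟩

theorem biInter {T : Set (Set (ι → N))} (hT : T.Finite) (h : ∀ E ∈ T, RealDefinable A E) :
    RealDefinable A (⋂₀ T) := by
  induction T, hT using Set.Finite.induction_on with
  | empty => simpa using univ A ι
  | insert _ _ ih =>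
    rw [Set.sInter_insert]
    exact (h _ (Set.mem_insert _ _)).inter (ih fun E hE => h E (Set.mem_insert_of_mem _ hE))

theorem biUnion {T : Set (Set (ι → N))} (hT : T.Finite) (h : ∀ E ∈ T, RealDefinable A E) :
    RealDefinable A (⋃₀ T) := by
  induction T, hT using Set.Finite.induction_on with
  | empty => simpa using empty A ι
  | insert _ _ ih =>
    rw [Set.sUnion_insert]
    exact (h _ (Set.mem_insert _ _)).union (ih fun E hE => h E (Set.mem_insert_of_mem _ hE))

theorem mono (h : RealDefinable A E) (hAB : A ⊆ B) : RealDefinable B E := by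
  obtain ⟨X, hX, hE⟩ := h
  refine ⟨_, hX.preimage_comp (Sum.map
    (fun k : ParamVars A => (⟨⟨k.1, hAB k.1.2⟩, k.2⟩ : ParamVars B)) (id : ι → ι)), ?_⟩
  intro y hy v
  rw [← hE (fun k => y ⟨⟨k.1, hAB k.1.2⟩, k.2⟩) (fun e => hy ⟨e, hAB e.2⟩) v, Set.mem_preimage,
    Sum.elim_comp_map]
  rfl

theorem comp_mem_iff (h : RealDefinable A E) {σ : N ≃[L] N} (hσ : Fixes σ A) (v : ι → N) :
    σ ∘ v ∈ E ↔ v ∈ E := by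
  obtain ⟨X, hX, hE⟩ := h
  obtain ⟨y, hy⟩ := Reps.nonempty A
  rw [← hE _ (Reps.map hσ hy), ← hE y hy, ← Sum.comp_elim, hX.comp_mem_iff]

/-- Only finitely many elements of `A` occur as parameters in the definition of `E`. -/
theorem exists_tuple (h : RealDefinable A E) :
    ∃ (l : ℕ) (r : Fin l → EqSort L N) (d : Tuple r), d.coords ⊆ A ∧
      ∃ X : Set (ι ⊕ RealVars r → N), ZDef L X ∧
        ∀ z, Tuple.mk r z = d → ∀ v, Sum.elim v z ∈ X ↔ v ∈ E := by
  classical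
  obtain ⟨X, hX, hE⟩ := h
  obtain ⟨φ, rfl⟩ := Set.empty_definable_iff.1 hX
  let F : Finset A := φ.freeVarFinset.toLeft.image Sigma.fst
  obtain ⟨l, ⟨e⟩⟩ := Finite.exists_equiv_fin F
  let r : Fin l → EqSort L N := fun i => (e.symm i).1.1.1
  let d : Tuple r := fun i => (e.symm i).1.1.2
  let g : RealVars r → ParamVars A := fun k => ⟨(e.symm k.1).1, k.2⟩
  have hg : Function.Injective g := by
    rintro ⟨i, j⟩ ⟨i', j'⟩ h
    obtain rfl : i = i' := e.symm.injective (Subtype.ext (Sigma.mk.inj h).1)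
    simpa [g] using h
  have hgr : ∀ k : ParamVars A, k.1 ∈ F → ∃ j, g j = k := by
    rintro ⟨a, i⟩ ha
    obtain ⟨j, hj⟩ := e.symm.surjective ⟨a, ha⟩
    obtain rfl : (e.symm j).1 = a := congrArg Subtype.val hj
    exact ⟨⟨j, i⟩, rfl⟩
  have hf : ∀ a : φ.freeVarFinset, ∃ b : ι ⊕ RealVars r,
      Sum.elim Sum.inr (Sum.inl ∘ g) b = a.1 := by
    rintro ⟨k | i, hk⟩
    · obtain ⟨j, hj⟩ := hgr k
        (Finset.mem_image.2 ⟨k, by simpa using hk, rfl⟩)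
      exact ⟨Sum.inr j, congrArg Sum.inl hj⟩
    · exact ⟨Sum.inl i, rfl⟩
  choose f hf using hf
  refine ⟨l, r, d, ?_, {v | FirstOrder.Language.Formula.Realize (φ.restrictFreeVar f) v},
    zDef_setOf_realize _, fun z hz v => ?_⟩
  · rintro _ ⟨i, rfl⟩
    exact (e.symm i).1.2
  · obtain ⟨y₀, hy₀⟩ := Reps.nonempty A
    have hy : Function.extend g z y₀ ∈ Reps A := by
      intro a
      by_cases ha : a ∈ F
      · obtain ⟨j, hj⟩ := e.symm.surjective ⟨a, ha⟩
        obtain rfl : (e.symm j).1 = a := congrArg Subtype.val hj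
        refine Eq.trans ?_ (congrFun hz j)
        refine congrArg (r j).cls (funext fun i => ?_)
        exact hg.extend_apply z y₀ ⟨j, i⟩
      · refine Eq.trans ?_ (hy₀ a)
        refine congrArg a.1.1.cls (funext fun i => ?_)
        refine Function.extend_apply' _ _ _ ?_
        rintro ⟨j, hj⟩
        refine ha ?_
        rw [← (Sigma.mk.inj hj).1]
        exact (e.symm j.1).2
    rw [← hE _ hy v]
    refine FirstOrder.Language.BoundedFormula.realize_restrictFreeVar _ fun a => ?_
    rw [← hf a]
    rcases f a with i | j
    · rfl
    · exact (hg.extend_apply z y₀ j).symm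

theorem preimage_comp {κ' : Type*} (h : RealDefinable A E) (f : ι → κ') :
    RealDefinable A {v : κ' → N | v ∘ f ∈ E} := by
  obtain ⟨X, hX, hE⟩ := h
  refine ⟨_, hX.preimage_comp (Sum.map id f), fun y hy v => ?_⟩
  rw [Set.mem_ofPred_eq, ← hE y hy (v ∘ f), Set.mem_preimage, Sum.elim_comp_map]
  rfl

end RealDefinable

theorem DefinableOver.realDefinable {A : Set (Imag L N)} {X : Set (Tuple s)}
    (h : DefinableOver A X) : RealDefinable A {v | Tuple.mk s v ∈ X} := by
  obtain ⟨l, r, c, R, hc, hR, rfl⟩ := h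
  refine ⟨_, hR.preimage_comp (Sum.elim Sum.inr
    fun k => Sum.inl ⟨⟨⟨r k.1, c k.1⟩, hc ⟨k.1, rfl⟩⟩, k.2⟩), fun y hy v => ?_⟩
  have : Tuple.mk r (fun k => y ⟨⟨⟨r k.1, c k.1⟩, hc ⟨k.1, rfl⟩⟩, k.2⟩) = c :=
    funext fun i => hy ⟨⟨r i, c i⟩, hc ⟨i, rfl⟩⟩
  conv_rhs => rw [← this]
  rfl

theorem zeroDefinable_of_zDef {X : Set (RealVars s ⊕ RealVars t → N)} (hX : ZDef L X) :
    ZeroDefinable {p : Tuple s × Tuple t |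
      ∃ v z, Tuple.mk s v = p.1 ∧ Tuple.mk t z = p.2 ∧ Sum.elim v z ∈ X} := by
  have h := ((zDef_mk_eq_mk (L := L) (N := N) (s := s)
    (α := (RealVars s ⊕ RealVars t) ⊕ (RealVars s ⊕ RealVars t))
    (Sum.inr ∘ Sum.inl) (Sum.inl ∘ Sum.inl)).inter ((zDef_mk_eq_mk (s := t)
    (Sum.inr ∘ Sum.inr) (Sum.inl ∘ Sum.inr)).inter (hX.preimage_comp Sum.inr))).exists_of_finite
  unfold ZeroDefinable
  convert h using 1
  ext u
  constructor
  · rintro ⟨v, z, h1, h2, h3⟩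
    exact ⟨Sum.elim v z, h1, h2, h3⟩
  · rintro ⟨x, h1, h2, h3⟩
    refine ⟨x ∘ Sum.inl, x ∘ Sum.inr, h1, h2, ?_⟩
    rw [Sum.elim_comp_inl_inr]
    exact h3

theorem RealDefinable.definableOver {A : Set (Imag L N)} {X : Set (Tuple s)}
    (h : RealDefinable A {v | Tuple.mk s v ∈ X}) : DefinableOver A X := by
  obtain ⟨l, r, d, hd, Z, hZ, hE⟩ := h.exists_tuple
  refine ⟨l, r, d, _, hd, zeroDefinable_of_zDef hZ, ?_⟩
  ext x
  constructor
  · intro hx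
    obtain ⟨v, rfl⟩ := x.exists_mk
    obtain ⟨z, hz⟩ := d.exists_mk
    exact ⟨v, z, rfl, hz, (hE z hz v).2 hx⟩
  · rintro ⟨v, z, rfl, hz, hx⟩
    exact (hE z hz v).1 hx

theorem DefinableOver.mono {A B : Set (Imag L N)} {X : Set (Tuple s)} (h : DefinableOver A X)
    (hAB : A ⊆ B) : DefinableOver B X := by
  obtain ⟨l, r, c, R, hc, hR, rfl⟩ := h
  exact ⟨l, r, c, R, hc.trans hAB, hR, rfl⟩

theorem DefinableOver.sInter {A : Set (Imag L N)} {F : Set (Set (Tuple s))} (hF : F.Finite)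
    (h : ∀ X ∈ F, DefinableOver A X) : DefinableOver A (⋂₀ F) := by
  have := RealDefinable.biInter (hF.image fun X => {v | Tuple.mk s v ∈ X})
    (by rintro _ ⟨X, hX, rfl⟩; exact (h X hX).realDefinable)
  refine RealDefinable.definableOver ?_
  convert this using 1
  ext v
  simp

/-- The translate of the set defined by `φ(x, b)` is defined by `φ(x, σ b)`. -/
theorem fiber_map {R : Set (Tuple s × Tuple t)} (hR : ZeroDefinable R) (σ : N ≃[L] N)
    (b : Tuple t) : Tuple.map σ '' fiber R b = fiber R (b.map σ) := by
  have key : ∀ (τ : N ≃[L] N) (x : Tuple s) (c : Tuple t), (x, c) ∈ R → (x.map τ, c.map τ) ∈ R := by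
    intro τ x c h
    obtain ⟨v, rfl⟩ := x.exists_mk
    obtain ⟨z, rfl⟩ := c.exists_mk
    have := (ZDef.comp_mem_iff hR τ (Sum.elim v z)).2 h
    exact this
  ext x
  rw [Tuple.mem_image_map]
  refine ⟨fun h => ?_, fun h => ?_⟩
  · simpa [Tuple.map_map_symm, fiber] using key σ _ _ h
  · simpa [Tuple.map_symm_map, fiber] using key σ.symm _ _ h

theorem DefinableOver.map_mem_iff {A : Set (Imag L N)} {X : Set (Tuple s)}
    (h : DefinableOver A X) {σ : N ≃[L] N} (hσ : Fixes σ A) (x : Tuple s) :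
    x.map σ ∈ X ↔ x ∈ X := by
  obtain ⟨v, rfl⟩ := x.exists_mk
  exact h.realDefinable.comp_mem_iff hσ v

theorem IsDefinable.image_map {X : Set (Tuple s)} (h : IsDefinable X) (σ : N ≃[L] N) :
    IsDefinable (Tuple.map σ '' X) := by
  obtain ⟨l, r, c, R, -, hR, rfl⟩ := h
  exact ⟨l, r, c.map σ, R, Set.subset_univ _, hR, fiber_map hR σ c⟩

end Definability

/-! ### Compactness and homogeneity for `N^eq` -/

section Compactness

variable {L : FirstOrder.Language.{u, v}} {N : Type w} [L.Structure N]
variable {m n : ℕ} {s : Fin m → EqSort L N} {t : Fin n → EqSort L N} {κ : Cardinal.{w}}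

theorem mk_paramVars_le (A : Set (Imag L N)) : #(ParamVars A) ≤ #A * ℵ₀ := by
  have h : Function.Injective fun k : ParamVars A => (k.1, (k.2 : ℕ)) := by
    rintro ⟨a, i⟩ ⟨b, j⟩ h
    obtain rfl : a = b := congrArg Prod.fst h
    obtain rfl : i = j := Fin.ext (congrArg Prod.snd h)
    rfl
  simpa using Cardinal.mk_le_of_injective h

theorem IsMonster.mk_paramVars_lt (hN : IsMonster L N κ) {A : Set (Imag L N)} (hA : #A < κ) :
    #(ParamVars A) < κ :=
  (mk_paramVars_le A).trans_lt (Cardinal.mul_lt_of_lt hN.aleph0_lt.le hA hN.aleph0_lt)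

/-- Saturation for sets definable over a small subset of `N^eq`. -/
theorem IsMonster.exists_mem_realDefinable (hN : IsMonster L N κ) {A : Set (Imag L N)}
    (hA : #A < κ) {J : Type*} (hJ : Cardinal.lift.{w} #J < Cardinal.lift κ)
    (S : Set (Set (J → N))) (hS : ∀ E ∈ S, RealDefinable A E)
    (fip : ∀ F ⊆ S, F.Finite → (⋂₀ F).Nonempty) : (⋂₀ S).Nonempty := by
  obtain ⟨y, hy⟩ := Reps.nonempty A
  choose! X hX hXE using hS
  obtain ⟨x, hx⟩ := hN.exists_mem hJ y
    (Cardinal.mk_range_le.trans_lt (hN.mk_paramVars_lt hA)) (X '' S)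
    (by rintro _ ⟨E, hE, rfl⟩; exact hX E hE) (by
      intro F hF hFf
      have : Finite F := hFf
      choose E hE hXF using fun Z : F => hF Z.2
      obtain ⟨x, hx⟩ := fip (Set.range E) (by rintro _ ⟨Z, rfl⟩; exact hE Z) (Set.finite_range E)
      refine ⟨x, fun Z hZ => ?_⟩
      rw [← show X (E ⟨Z, hZ⟩) = Z from hXF ⟨Z, hZ⟩]
      exact (hXE _ (hE _) y hy x).2 (hx _ ⟨⟨Z, hZ⟩, rfl⟩))
  exact ⟨x, fun E hE => (hXE E hE y hy x).1 (hx _ ⟨E, hE, rfl⟩)⟩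

/-- The tuples which have the same type over a small set `A ⊆ N^eq` as a given tuple are its
conjugates over `A`. -/
theorem IsMonster.exists_fixes (hN : IsMonster L N κ) {A : Set (Imag L N)} (hA : #A < κ)
    {ι : Type} [Finite ι] (v v' : ι → N)
    (h : ∀ E : Set (ι → N), RealDefinable A E → v ∈ E → v' ∈ E) :
    ∃ σ : N ≃[L] N, Fixes σ A ∧ σ ∘ v = v' := by
  classical
  obtain ⟨y, hy⟩ := Reps.nonempty A
  -- a finite part of the type of `y` and `v` is realized by `v'` and some representatives of `A`
  have key : ∀ X : Set (ParamVars A ⊕ ι → N), ZDef L X → Sum.elim y v ∈ X →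
      ∃ y' ∈ Reps A, Sum.elim y' v' ∈ X := by
    intro X hX hyv
    obtain ⟨T, hT⟩ := hX.exists_support
    let F : Finset A := T.toLeft.image Sigma.fst
    have hF : ∀ k, Sum.inl k ∈ T → k.1 ∈ F := fun k hk =>
      Finset.mem_image.2 ⟨k, by simpa using hk, rfl⟩
    let J := {k : ParamVars A // k.1 ∈ F}
    have : Finite J := Finite.of_injective
      (fun k : J => (⟨⟨k.1.1, k.2⟩, k.1.2⟩ : Σ e : F, Fin e.1.1.1.arity)) (by
        rintro ⟨⟨a, i⟩, ha⟩ ⟨⟨b, j⟩, hb⟩ hab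
        obtain rfl : a = b := congrArg Subtype.val (Sigma.mk.inj hab).1
        obtain rfl : i = j := eq_of_heq (Sigma.mk.inj hab).2
        rfl)
    -- `f` lets the quantified variables replace the parameters which occur in `X`
    let f : ParamVars A ⊕ ι → (ParamVars A ⊕ ι) ⊕ J :=
      Sum.elim (fun k => if h : k.1 ∈ F then .inr ⟨k, h⟩ else .inl (.inl k)) (.inl ∘ .inr)
    have hf : ∀ y₁ (u : ι → N) (y₂ : ParamVars A → N),
        Sum.elim (Sum.elim y₁ u) (fun k : J => y₂ k.1) ∘ f =
          Sum.elim (fun k => if k.1 ∈ F then y₂ k else y₁ k) u := by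
      intro y₁ u y₂
      ext (k | i)
      · by_cases hk : k.1 ∈ F <;> simp [f, hk]
      · rfl
    have hrep : ∀ y₁ ∈ Reps A, ∀ y₂ : ParamVars A → N,
        (∀ e : F, e.1.1.1.rel (fun i => y₂ ⟨e, i⟩) (fun i => y₁ ⟨e, i⟩)) →
        (fun k => if k.1 ∈ F then y₂ k else y₁ k) ∈ Reps A := by
      intro y₁ hy₁ y₂ h e
      by_cases he : e ∈ F
      · simp only [he, if_true]
        rw [← hy₁ e]
        exact Quotient.sound (h ⟨e, he⟩)
      · simp only [he, if_false]
        exact hy₁ e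
    have hrel : ∀ e : F, ZDef L {u : (ParamVars A ⊕ ι) ⊕ J → N |
        e.1.1.1.rel (fun i => u (.inr ⟨⟨e, i⟩, e.2⟩)) (fun i => u (.inl (.inl ⟨e, i⟩)))} :=
      fun e => zDef_rel _ _ _
    have hE : RealDefinable A {u : ι → N | ∃ y' ∈ Reps A, Sum.elim y' u ∈ X} := by
      refine ⟨_, ((zDef_forall hrel).inter (hX.preimage_comp f)).exists_of_finite,
        fun y₁ hy₁ u => ?_⟩
      constructor
      · rintro ⟨z, hz1, hz2⟩
        let y₂ : ParamVars A → N := fun k => if h : k.1 ∈ F then z ⟨k, h⟩ else y₁ k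
        have hz : (fun k : J => y₂ k.1) = z := funext fun k => dif_pos k.2
        rw [← hz] at hz1 hz2
        refine ⟨_, hrep y₁ hy₁ y₂ hz1, ?_⟩
        rw [← hf]
        exact hz2
      · rintro ⟨y₂, hy₂, hu⟩
        refine ⟨fun k => y₂ k.1, fun e => ?_, ?_⟩
        · exact Quotient.exact ((hy₂ e).trans (hy₁ e).symm)
        · rw [Set.mem_preimage, hf]
          refine hT _ _ ?_ hu
          rintro (k | i) hk
          · simp [hF k hk]
          · rfl
    exact h _ hE ⟨y, hy, hyv⟩
  have hcard : #(ParamVars A ⊕ ι) < κ := by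
    rw [Cardinal.mk_sum, Cardinal.lift_uzero]
    refine Cardinal.add_lt_of_lt hN.aleph0_lt.le (hN.mk_paramVars_lt hA) ?_
    exact lt_of_lt_of_le (by simp) hN.aleph0_lt.le
  -- realize the whole type
  let S : Set (Set ((ParamVars A ⊕ ι) ⊕ ParamVars A → N)) :=
    {Z | ZDef L Z ∧ ∃ X, ZDef L X ∧ Sum.elim y v ∈ X ∧
      ∀ y' ∈ Reps A, Sum.elim y' v' ∈ X → Sum.elim (Sum.elim y v') y' ∈ Z}
  obtain ⟨y', hy'⟩ := hN.exists_mem (J := ParamVars A)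
    (by simpa using hN.mk_paramVars_lt hA) (Sum.elim y v')
    (Cardinal.mk_range_le.trans_lt hcard)
    S (fun Z hZ => hZ.1) (by
      intro F hF hFf
      have : Finite F := hFf
      choose X hX hyX hXZ using fun Z : F => (hF Z.2).2
      obtain ⟨y', hy', h'⟩ := key {u | ∀ Z : F, u ∈ X Z} (zDef_forall hX) hyX
      exact ⟨y', fun Z hZ => hXZ ⟨Z, hZ⟩ y' hy' (h' ⟨Z, hZ⟩)⟩)
  have hy'A : y' ∈ Reps A := by
    intro e
    rw [← hy e]
    refine Quotient.sound (hy' {u | e.1.1.rel (fun i => u (.inr ⟨e, i⟩))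
      (fun i => u (.inl (.inl ⟨e, i⟩)))} ⟨zDef_rel _ _ _, Set.univ, Set.definable_univ,
        trivial, fun y₁ hy₁ _ => ?_⟩)
    exact Quotient.exact ((hy₁ e).trans (hy e).symm)
  obtain ⟨σ, hσ⟩ := hN.exists_aut (J := ParamVars A ⊕ ι) (by simpa using hcard)
    (Sum.elim y v) (Sum.elim y' v') (by
      intro X hX hyX
      have hcomp : ∀ y₁ : ParamVars A → N, Sum.elim (Sum.elim y v') y₁ ∘
          Sum.elim Sum.inr (Sum.inl ∘ Sum.inr) = Sum.elim y₁ v' := fun y₁ => by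
        ext (k | i) <;> rfl
      have := hy' {u | u ∘ Sum.elim Sum.inr (Sum.inl ∘ Sum.inr) ∈ X}
        ⟨hX.preimage_comp _, X, hX, hyX, fun y₁ _ h₁ => ?_⟩
      · rwa [Set.mem_ofPred_eq, hcomp] at this
      · rwa [Set.mem_ofPred_eq, hcomp])
  have hσy : σ ∘ y = y' := funext fun k => hσ (.inl k)
  exact ⟨σ, Reps.fixes hy (hσy ▸ hy'A), funext fun i => hσ (.inr i)⟩

end Compactness

/-! ### Invariant sets and algebraic closure -/

section Invariance

variable {L : FirstOrder.Language.{u, v}} {N : Type w} [L.Structure N]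
variable {m n : ℕ} {s : Fin m → EqSort L N} {t : Fin n → EqSort L N} {κ : Cardinal.{w}}

theorem Tuple.finite_coords (a : Tuple s) : a.coords.Finite := Set.finite_range _

theorem IsMonster.lt_of_finite (hN : IsMonster L N κ) {A : Set (Imag L N)} (hA : A.Finite) :
    #A < κ :=
  (Cardinal.lt_aleph0_iff_set_finite.2 hA).trans hN.aleph0_lt

theorem IsMonster.union_lt (hN : IsMonster L N κ) {A B : Set (Imag L N)} (hA : #A < κ)
    (hB : #B < κ) : #(A ∪ B : Set (Imag L N)) < κ :=
  (Cardinal.mk_union_le A B).trans_lt (Cardinal.add_lt_of_lt hN.aleph0_lt.le hA hB)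

theorem IsMonster.lift_mk_lt_of_countable (hN : IsMonster L N κ) (J : Type) [Countable J] :
    Cardinal.lift.{w} #J < Cardinal.lift.{0} κ := by
  rw [Cardinal.lift_uzero]
  exact lt_of_le_of_lt (by simp) hN.aleph0_lt

theorem RealDefinable.of_zDef {A : Set (Imag L N)} {ι : Type*} {X : Set (ι → N)}
    (hX : ZDef L X) : RealDefinable A X :=
  ⟨_, hX.preimage_comp Sum.inr, fun _ _ _ => Iff.rfl⟩

/-- Compactness for sets of tuples from `N^eq`. -/
theorem IsMonster.exists_tuple_mem (hN : IsMonster L N κ) {A : Set (Imag L N)} (hA : #A < κ)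
    (S : Set (Set (Tuple s))) (hS : ∀ X ∈ S, DefinableOver A X)
    (fip : ∀ F ⊆ S, F.Finite → (⋂₀ F).Nonempty) : (⋂₀ S).Nonempty := by
  obtain ⟨v, hv⟩ := hN.exists_mem_realDefinable hA (hN.lift_mk_lt_of_countable (RealVars s))
    ((fun X => {v | Tuple.mk s v ∈ X}) '' S)
    (by rintro _ ⟨X, hX, rfl⟩; exact (hS X hX).realDefinable) (by
      intro F hF hFf
      obtain ⟨F', ⟨hF'S, hF'f⟩, rfl⟩ : ∃ F' : Set (Set (Tuple s)), (F' ⊆ S ∧ F'.Finite) ∧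
          (fun X => {v : RealVars s → N | Tuple.mk s v ∈ X}) '' F' = F := by
        have hinj : Function.Injective
            (fun X : Set (Tuple s) => {v : RealVars s → N | Tuple.mk s v ∈ X}) := by
          intro X Y h
          ext x
          obtain ⟨v, rfl⟩ := x.exists_mk
          exact Set.ext_iff.1 h v
        obtain ⟨F', h1, rfl⟩ := Set.subset_image_iff.1 hF
        exact ⟨F', ⟨h1, hFf.of_finite_image hinj.injOn⟩, rfl⟩
      obtain ⟨x, hx⟩ := fip F' hF'S hF'f
      obtain ⟨v, rfl⟩ := x.exists_mk
      refine ⟨v, ?_⟩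
      rintro _ ⟨X, hX, rfl⟩
      exact hx X hX)
  exact ⟨Tuple.mk s v, fun X hX => hv _ ⟨X, hX, rfl⟩⟩

/-- A set definable over some small set, and invariant under the automorphisms over the small
set `A`, is definable over `A`. -/
theorem IsMonster.realDefinable_of_invariant (hN : IsMonster L N κ) {A B : Set (Imag L N)}
    (hA : #A < κ) (hB : #B < κ) {ι : Type} [Finite ι] {E : Set (ι → N)}
    (hE : RealDefinable B E) (hinv : ∀ σ : N ≃[L] N, Fixes σ A → ∀ v ∈ E, σ ∘ v ∈ E) :
    RealDefinable A E := by
  have hAB := hN.union_lt hA hB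
  -- each point of `E` has an `A`-definable neighbourhood contained in `E`
  have h1 : ∀ v ∈ E, ∃ D, RealDefinable A D ∧ v ∈ D ∧ D ⊆ E := by
    intro v hv
    by_contra! hcon
    obtain ⟨v', hv'⟩ := hN.exists_mem_realDefinable hAB (hN.lift_mk_lt_of_countable ι)
      (insert Eᶜ {D | RealDefinable A D ∧ v ∈ D}) (by
        rintro D (rfl | hD)
        · exact hE.compl.mono Set.subset_union_right
        · exact hD.1.mono Set.subset_union_left) (by
        intro F hF hFf
        have h2 := Set.not_subset.1 (hcon (⋂₀ (F ∩ {D | RealDefinable A D ∧ v ∈ D}))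
          (RealDefinable.biInter (hFf.subset Set.inter_subset_left) fun D hD => hD.2.1)
          (fun D hD => hD.2.2))
        obtain ⟨v', hv', hv'E⟩ := h2
        refine ⟨v', fun D hD => ?_⟩
        rcases hF hD with rfl | hD'
        · exact hv'E
        · exact hv' D ⟨hD, hD'⟩)
    obtain ⟨σ, hσ, rfl⟩ := hN.exists_fixes hA v v' fun D hD hvD =>
      hv' D (Or.inr ⟨hD, hvD⟩)
    exact hv' Eᶜ (Or.inl rfl) (hinv σ hσ v hv)
  by_contra hcon
  -- finitely many of these neighbourhoods cover `E`
  obtain ⟨v, hv⟩ := hN.exists_mem_realDefinable hAB (hN.lift_mk_lt_of_countable ι)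
    (insert E {D | RealDefinable A D ∧ Dᶜ ⊆ E}) (by
      rintro D (rfl | hD)
      · exact hE.mono Set.subset_union_right
      · exact hD.1.mono Set.subset_union_left) (by
      intro F hF hFf
      by_contra hemp
      have hF' : RealDefinable A (⋂₀ (F ∩ {D | RealDefinable A D ∧ Dᶜ ⊆ E})) :=
        RealDefinable.biInter (hFf.subset Set.inter_subset_left) fun D hD => hD.2.1
      refine hcon ?_
      convert hF'.compl using 1
      ext v
      constructor
      · refine fun hv hv' => hemp ⟨v, fun D hD => ?_⟩
        rcases hF hD with rfl | hD'
        · exact hv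
        · exact hv' D ⟨hD, hD'⟩
      · intro hv
        obtain ⟨D, hD⟩ := not_forall.1 hv
        obtain ⟨hD1, hD2⟩ := Classical.not_imp.1 hD
        exact hD1.2.2 hD2)
  obtain ⟨D, hD, hvD, hDE⟩ := h1 v (hv E (Or.inl rfl))
  exact hv Dᶜ (Or.inr ⟨hD.compl, by rwa [compl_compl]⟩) hvD

theorem IsMonster.definableOver_of_invariant (hN : IsMonster L N κ) {A B : Set (Imag L N)}
    (hA : #A < κ) (hB : #B < κ) {X : Set (Tuple s)} (hX : DefinableOver B X)
    (hinv : ∀ σ : N ≃[L] N, Fixes σ A → ∀ x ∈ X, x.map σ ∈ X) : DefinableOver A X :=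
  (hN.realDefinable_of_invariant hA hB hX.realDefinable
    fun σ hσ v hv => hinv σ hσ (Tuple.mk s v) hv).definableOver

theorem DefinableOver.sUnion {A : Set (Imag L N)} {F : Set (Set (Tuple s))} (hF : F.Finite)
    (h : ∀ X ∈ F, DefinableOver A X) : DefinableOver A (⋃₀ F) := by
  have := RealDefinable.biUnion (hF.image fun X => {v | Tuple.mk s v ∈ X})
    (by rintro _ ⟨X, hX, rfl⟩; exact (h X hX).realDefinable)
  refine RealDefinable.definableOver ?_
  convert this using 1
  ext v
  simp

theorem definableOver_singleton (b : Tuple s) : DefinableOver b.coords {b} :=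
  ⟨m, s, b, {p | p.1 = p.2}, subset_rfl, zDef_mk_eq_mk Sum.inl Sum.inr, rfl⟩

/-- An element of a sort, as a tuple of length one. -/
def Tuple.single {S : EqSort L N} (e : S.Carrier) : Tuple (fun _ : Fin 1 => S) := fun _ => e

/-- The conjugates of the tuple `b` over `A`. -/
def orbit (A : Set (Imag L N)) (b : Tuple s) : Set (Tuple s) :=
  {b' | ∃ σ : N ≃[L] N, Fixes σ A ∧ b' = b.map σ}

theorem mem_orbit_self (A : Set (Imag L N)) (b : Tuple s) : b ∈ orbit A b :=
  ⟨_, Fixes.refl A, b.map_refl.symm⟩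

theorem IsMonster.definableOver_orbit (hN : IsMonster L N κ) {A : Set (Imag L N)} (hA : #A < κ)
    {b : Tuple s} (h : (orbit A b).Finite) : DefinableOver A (orbit A b) := by
  refine hN.definableOver_of_invariant hA
    (hN.lt_of_finite (h.biUnion fun b' _ => b'.finite_coords)) (B := ⋃ b' ∈ orbit A b, b'.coords)
    ?_ ?_
  · have := DefinableOver.sUnion (A := ⋃ b' ∈ orbit A b, b'.coords)
      (h.image fun b' => ({b'} : Set (Tuple s))) (by
        rintro _ ⟨b', hb', rfl⟩
        exact (definableOver_singleton b').mono (Set.subset_biUnion_of_mem hb'))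
    convert this using 1
    simp
  · rintro σ hσ _ ⟨τ, hτ, rfl⟩
    exact ⟨σ.comp τ, hσ.comp hτ, (Tuple.map_comp σ τ b).symm⟩

/-- A tuple with finitely many conjugates over a small set is algebraic over it. -/
theorem IsMonster.coords_subset_acl (hN : IsMonster L N κ) {A : Set (Imag L N)} (hA : #A < κ)
    {b : Tuple s} (h : (orbit A b).Finite) : b.coords ⊆ acl A := by
  rintro _ ⟨i, rfl⟩
  have hfin : (orbit A (Tuple.single (b i))).Finite := by
    refine (h.image fun b' => Tuple.single (b' i)).subset ?_
    rintro _ ⟨σ, hσ, rfl⟩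
    exact ⟨b.map σ, ⟨σ, hσ, rfl⟩, rfl⟩
  exact ⟨_, hN.definableOver_orbit hA hfin, hfin, mem_orbit_self A _⟩

theorem finite_orbit_of_mem_acl {A : Set (Imag L N)} {S : EqSort L N} {e : S.Carrier}
    (h : (⟨S, e⟩ : Imag L N) ∈ acl A) :
    (orbit A (Tuple.single e)).Finite := by
  obtain ⟨X, hX, hfin, he⟩ := h
  refine hfin.subset ?_
  rintro _ ⟨σ, hσ, rfl⟩
  exact (hX.map_mem_iff hσ _).2 he

end Invariance

/-! ### Inconsistency of the conjugates of a weakly normal set -/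

section WeaklyNormal

variable {L : FirstOrder.Language.{u, v}} {N : Type w} [L.Structure N]
variable {m n : ℕ} {s : Fin m → EqSort L N} {t : Fin n → EqSort L N} {κ : Cardinal.{w}}

theorem zDef_fiber_eq {R : Set (Tuple s × Tuple t)} (hR : ZeroDefinable R) {α : Type*}
    (f g : RealVars t → α) :
    ZDef L {u : α → N | fiber R (Tuple.mk t (u ∘ f)) = fiber R (Tuple.mk t (u ∘ g))} := by
  have h1 : ZDef L {u : α ⊕ RealVars s → N | (Tuple.mk s (u ∘ Sum.inr),
      Tuple.mk t (u ∘ Sum.inl ∘ f)) ∈ R} :=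
    hR.preimage_comp (Sum.elim Sum.inr (Sum.inl ∘ f))
  have h2 : ZDef L {u : α ⊕ RealVars s → N | (Tuple.mk s (u ∘ Sum.inr),
      Tuple.mk t (u ∘ Sum.inl ∘ g)) ∈ R} :=
    hR.preimage_comp (Sum.elim Sum.inr (Sum.inl ∘ g))
  have h3 := ((h1.compl.union h2).inter (h2.compl.union h1)).forall_of_finite
  convert h3 using 1
  ext u
  simp only [Set.mem_ofPred_eq, Set.ext_iff, fiber, Set.mem_inter_iff, Set.mem_union,
    Set.mem_compl_iff, ← imp_iff_not_or, ← iff_def]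
  refine ⟨fun h v => h _, fun h x => ?_⟩
  obtain ⟨v, rfl⟩ := x.exists_mk
  exact h v

/-- If a definable set is weakly normal relative to a small set `A`, then its conjugates over `A`
are `k`-inconsistent for some `k`. This holds more generally for the instances whose parameters
belong to a single `A`-definable set `E`, a finite part of the type of `z` over `A`. -/
theorem IsMonster.exists_inconsistent (hN : IsMonster L N κ) {A : Set (Imag L N)} (hA : #A < κ)
    {R : Set (Tuple s × Tuple t)} (hR : ZeroDefinable R) (z : RealVars t → N)
    (hX : WeaklyNormal A (fiber R (Tuple.mk t z))) :
    ∃ E : Set (RealVars t → N), RealDefinable A E ∧ z ∈ E ∧ ∃ k : ℕ,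
      ∀ b : Fin k → RealVars t → N, (∀ i, b i ∈ E) →
        Function.Injective (fun i => fiber R (Tuple.mk t (b i))) →
        ∀ x ∈ fiber R (Tuple.mk t z), ∃ i, x ∉ fiber R (Tuple.mk t (b i)) := by
  classical
  by_contra! hcon
  let A' := A ∪ (Tuple.mk t z).coords
  have hA' : #A' < κ := hN.union_lt hA (hN.lt_of_finite (Tuple.finite_coords _))
  let J := RealVars s ⊕ ℕ × RealVars t
  let x : (J → N) → Tuple s := fun u => Tuple.mk s (u ∘ Sum.inl)
  let y : (J → N) → ℕ → RealVars t → N := fun u i k => u (Sum.inr (i, k))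
  -- The type of a point `x u` of the set together with infinitely many parameters `y u i`, of the
  -- same type as `z` over `A`, whose instances are distinct and contain `x u`. It consists of the
  -- sets which contain every `u` with these properties up to a finite stage `l`, and with
  -- respect to a single `A`-definable set `E`.
  let S : Set (Set (J → N)) := {Z | RealDefinable A' Z ∧
    ∃ (l : ℕ) (E : Set (RealVars t → N)), RealDefinable A E ∧ z ∈ E ∧
      ∀ u : J → N, x u ∈ fiber R (Tuple.mk t z) →
        (∀ i < l, y u i ∈ E ∧ x u ∈ fiber R (Tuple.mk t (y u i))) →
        (∀ i < l, ∀ j < l, i ≠ j →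
          fiber R (Tuple.mk t (y u i)) ≠ fiber R (Tuple.mk t (y u j))) → u ∈ Z}
  obtain ⟨u, hu⟩ := hN.exists_mem_realDefinable hA' (hN.lift_mk_lt_of_countable J) S
    (fun Z hZ => hZ.1) (by
      intro F hF hFf
      have : Finite F := hFf
      choose l E hE hzE hZ using fun Z : F => (hF Z.2).2
      obtain ⟨l₀, hl₀⟩ := (Set.finite_range l).bddAbove
      obtain ⟨b, hbE, hb, x₀, hx₀, hxb⟩ := hcon (⋂₀ Set.range E)
        (RealDefinable.biInter (Set.finite_range E) (by rintro _ ⟨Z, rfl⟩; exact hE Z))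
        (by rintro _ ⟨Z, rfl⟩; exact hzE Z) (l₀ + 1)
      obtain ⟨v, rfl⟩ := x₀.exists_mk
      let u : J → N := Sum.elim v fun p =>
        if h : p.1 < l₀ + 1 then b ⟨p.1, h⟩ p.2 else z p.2
      have hy : ∀ i (h : i < l₀ + 1), y u i = b ⟨i, h⟩ := fun i h => by
        funext k
        exact dif_pos h
      refine ⟨u, fun Z hZF => hZ ⟨Z, hZF⟩ u hx₀ (fun i hi => ?_) (fun i hi j hj hij => ?_)⟩
      · have hi' : i < l₀ + 1 := Nat.lt_succ_of_le (hi.le.trans (hl₀ ⟨_, rfl⟩))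
        rw [hy i hi']
        exact ⟨hbE _ _ ⟨_, rfl⟩, hxb _⟩
      · have hi' : i < l₀ + 1 := Nat.lt_succ_of_le (hi.le.trans (hl₀ ⟨_, rfl⟩))
        have hj' : j < l₀ + 1 := Nat.lt_succ_of_le (hj.le.trans (hl₀ ⟨_, rfl⟩))
        rw [hy i hi', hy j hj']
        exact fun h => hij (congrArg Fin.val (hb h)))
  have hx : x u ∈ fiber R (Tuple.mk t z) := hu {u | x u ∈ fiber R (Tuple.mk t z)}
    ⟨((DefinableOver.realDefinable ⟨n, t, _, R, subset_rfl, hR, rfl⟩).preimage_comp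
      Sum.inl).mono Set.subset_union_right, 0, _, RealDefinable.univ A _, trivial,
      fun u hx _ _ => hx⟩
  have hmem : ∀ i, x u ∈ fiber R (Tuple.mk t (y u i)) := fun i =>
    hu {u | x u ∈ fiber R (Tuple.mk t (y u i))}
      ⟨RealDefinable.of_zDef
        (hR.preimage_comp (Sum.elim Sum.inl fun k => Sum.inr (i, k))),
        i + 1, _, RealDefinable.univ A _, trivial, fun u _ h _ => (h i i.lt_succ_self).2⟩
  have hne : ∀ i j, i ≠ j → fiber R (Tuple.mk t (y u i)) ≠ fiber R (Tuple.mk t (y u j)) :=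
    fun i j hij => hu {u | fiber R (Tuple.mk t (y u i)) ≠ fiber R (Tuple.mk t (y u j))}
      ⟨RealDefinable.of_zDef (zDef_fiber_eq hR _ _).compl,
        max i j + 1, _, RealDefinable.univ A _, trivial, fun u _ _ h =>
          h i (by omega) j (by omega) hij⟩
  have hconj : ∀ i, fiber R (Tuple.mk t (y u i)) ∈
      {Y ∈ conjugates A (fiber R (Tuple.mk t z)) | x u ∈ Y} := by
    intro i
    obtain ⟨σ, hσ, hσz⟩ := hN.exists_fixes hA z (y u i) fun E hE hzE =>
      hu {u | y u i ∈ E} ⟨(hE.preimage_comp fun k => Sum.inr (i, k)).mono Set.subset_union_left,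
        i + 1, E, hE, hzE, fun u _ h _ => (h i i.lt_succ_self).1⟩
    refine ⟨⟨σ, hσ, ?_⟩, hmem i⟩
    rw [fiber_map hR, Tuple.map_mk, hσz]
  exact Set.infinite_of_injective_forall_mem
    (fun i j h => by_contra fun hij => hne i j hij h) hconj (hX.2 _ hx)

end WeaklyNormal

/-! ### Conjugates of sets -/

section Conjugates

variable {L : FirstOrder.Language.{u, v}} {N : Type w} [L.Structure N]
variable {m n : ℕ} {s : Fin m → EqSort L N} {t : Fin n → EqSort L N} {κ : Cardinal.{w}}

theorem mem_conjugates_self (A : Set (Imag L N)) (X : Set (Tuple s)) : X ∈ conjugates A X :=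
  ⟨_, Fixes.refl A, by
    have : (Tuple.map (FirstOrder.Language.Equiv.refl L N) : Tuple s → Tuple s) = id :=
      funext Tuple.map_refl
    rw [this, Set.image_id]⟩

theorem conjugates_mono {A B : Set (Imag L N)} (h : A ⊆ B) (X : Set (Tuple s)) :
    conjugates B X ⊆ conjugates A X :=
  fun _ ⟨σ, hσ, hY⟩ => ⟨σ, hσ.mono h, hY⟩

theorem conjugates_trans {A : Set (Imag L N)} {X Y Z : Set (Tuple s)} (hY : Y ∈ conjugates A X)
    (hZ : Z ∈ conjugates A Y) : Z ∈ conjugates A X := by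
  obtain ⟨σ, hσ, rfl⟩ := hY
  obtain ⟨τ, hτ, rfl⟩ := hZ
  exact ⟨τ.comp σ, hτ.comp hσ, (Tuple.image_map_comp τ σ X).symm⟩

theorem conjugates_symm {A : Set (Imag L N)} {X Y : Set (Tuple s)} (hY : Y ∈ conjugates A X) :
    X ∈ conjugates A Y := by
  obtain ⟨σ, hσ, rfl⟩ := hY
  exact ⟨σ.symm, hσ.symm, (Tuple.image_map_symm_image σ X).symm⟩

theorem conjugates_eq_image_orbit {R : Set (Tuple s × Tuple t)} (hR : ZeroDefinable R)
    (A : Set (Imag L N)) (b : Tuple t) : conjugates A (fiber R b) = fiber R '' orbit A b := by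
  ext Y
  constructor
  · rintro ⟨σ, hσ, rfl⟩
    exact ⟨b.map σ, ⟨σ, hσ, rfl⟩, (fiber_map hR σ b).symm⟩
  · rintro ⟨_, ⟨σ, hσ, rfl⟩, rfl⟩
    exact ⟨σ, hσ, (fiber_map hR σ b).symm⟩

theorem image_mem_conjugates (σ : N ≃[L] N) {A : Set (Imag L N)} {X Y : Set (Tuple s)}
    (hY : Y ∈ conjugates A X) :
    Tuple.map σ '' Y ∈ conjugates (Imag.map σ '' A) (Tuple.map σ '' X) := by
  obtain ⟨τ, hτ, rfl⟩ := hY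
  refine ⟨(σ.comp τ).comp σ.symm, ?_, ?_⟩
  · rintro _ ⟨e, he, rfl⟩
    rw [Imag.map_comp, Imag.map_symm_map, Imag.map_comp, hτ e he]
  · rw [Tuple.image_map_comp, Tuple.image_map_symm_image, Tuple.image_map_comp]

theorem image_map_symm_mem_conjugates (σ : N ≃[L] N) {A : Set (Imag L N)} {X Y : Set (Tuple s)}
    (hY : Y ∈ conjugates (Imag.map σ '' A) (Tuple.map σ '' X)) :
    Tuple.map σ.symm '' Y ∈ conjugates A X := by
  have := image_mem_conjugates σ.symm hY
  rwa [Tuple.image_map_symm_image, Set.image_image, Set.image_congr fun e _ =>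
    Imag.map_symm_map σ e, Set.image_id'] at this

theorem Tuple.image_map_image_map_symm (σ : N ≃[L] N) (X : Set (Tuple s)) :
    Tuple.map σ '' (Tuple.map σ.symm '' X) = X :=
  Tuple.image_map_symm_image σ.symm X

theorem AlmostOver.of_image {σ : N ≃[L] N} {A : Set (Imag L N)} {X : Set (Tuple s)}
    (h : AlmostOver (Imag.map σ '' A) (Tuple.map σ '' X)) : AlmostOver A X :=
  (h.image fun Y => Tuple.map σ.symm '' Y).subset fun Y hY =>
    ⟨_, image_mem_conjugates σ hY, Tuple.image_map_symm_image σ Y⟩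

theorem WeaklyNormal.image {A : Set (Imag L N)} {X : Set (Tuple s)} (h : WeaklyNormal A X)
    (σ : N ≃[L] N) : WeaklyNormal (Imag.map σ '' A) (Tuple.map σ '' X) := by
  refine ⟨h.1.image _, ?_⟩
  rintro _ ⟨x, hx, rfl⟩
  refine ((h.2 x hx).image fun Y => Tuple.map σ '' Y).subset ?_
  rintro Y ⟨hY, hxY⟩
  exact ⟨_, ⟨image_map_symm_mem_conjugates σ hY, x.map σ, hxY, Tuple.map_symm_map σ x⟩,
    Tuple.image_map_image_map_symm σ Y⟩

/-- A conjugate of a set that divides over `A` divides over `A`. -/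
theorem Divides.of_mem_conjugates {A : Set (Imag L N)} {X Y : Set (Tuple s)} (h : Divides A X)
    (hY : Y ∈ conjugates A X) : Divides A Y := by
  obtain ⟨Z, hZ, hk⟩ := h
  exact ⟨Z, fun i => conjugates_trans (conjugates_symm hY) (hZ i), hk⟩

/-- A nonempty set which is almost over `A` does not divide over `A`: a sequence of its conjugates
has an infinite constant subsequence. -/
theorem AlmostOver.not_divides {A : Set (Imag L N)} {X : Set (Tuple s)} (h : AlmostOver A X)
    (hX : X.Nonempty) : ¬ Divides A X := by
  rintro ⟨Y, hY, k, -, hk⟩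
  have : Finite (conjugates A X) := h
  obtain ⟨⟨Z, hZ⟩, hinf⟩ := Finite.exists_infinite_fiber
    fun i => (⟨Y i, hY i⟩ : conjugates A X)
  obtain ⟨I, hI, hIk⟩ := (Set.infinite_coe_iff.1 hinf).exists_subset_card_eq k
  obtain ⟨x, hx⟩ : Z.Nonempty := by
    obtain ⟨σ, -, rfl⟩ := hZ
    exact hX.image _
  have : x ∈ ⋂ i ∈ I, Y i := Set.mem_iInter₂.2 fun i hi => by
    have : Y i = _ := congrArg Subtype.val (hI hi)
    rwa [this]
  rw [hk I hIk] at this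
  exact this

end Conjugates

/-! ### Weak normality and thorn dividing -/

section ThornDividing

variable {L : FirstOrder.Language.{u, v}} {N : Type w} [L.Structure N]
variable {m n : ℕ} {s : Fin m → EqSort L N} {t : Fin n → EqSort L N} {κ : Cardinal.{w}}

/-- A set definable over `A` is invariant under the automorphisms fixing some finite tuple from
`A`. -/
theorem RealDefinable.exists_tuple_invariant {A : Set (Imag L N)} {ι : Type*} {E : Set (ι → N)}
    (h : RealDefinable A E) :
    ∃ (l : ℕ) (r : Fin l → EqSort L N) (d : Tuple r), d.coords ⊆ A ∧
      ∀ σ : N ≃[L] N, Fixes σ d.coords → ∀ v ∈ E, σ ∘ v ∈ E := by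
  obtain ⟨l, r, d, hd, X, hX, hE⟩ := h.exists_tuple
  refine ⟨l, r, d, hd, fun σ hσ v hv => ?_⟩
  obtain ⟨z, hz⟩ := d.exists_mk
  have hz' : Tuple.mk r (σ ∘ z) = d := by
    rw [← Tuple.map_mk, hz, Tuple.map_eq_self_iff.2 hσ]
  rw [← hE _ hz', ← Sum.comp_elim, hX.comp_mem_iff, hE z hz]
  exact hv

/-- If a definable set is weakly normal relative to a small set `A`, then its conjugates over some
finite part of `A` are `k`-inconsistent for some `k`. -/
theorem WeaklyNormal.exists_inconsistent (hN : IsMonster L N κ) {A : Set (Imag L N)}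
    (hA : #A < κ) {X : Set (Tuple s)} (hd : IsDefinable X) (hX : WeaklyNormal A X) :
    ∃ (l : ℕ) (r : Fin l → EqSort L N) (d : Tuple r), d.coords ⊆ A ∧ ∃ k > 0,
      ∀ Y : Fin k → Set (Tuple s), Function.Injective Y → (∀ i, Y i ∈ conjugates d.coords X) →
        ⋂ i, Y i = ∅ := by
  obtain ⟨n, t, c, R, -, hR, rfl⟩ := hd
  obtain ⟨z, rfl⟩ := c.exists_mk
  obtain ⟨E, hE, hzE, k, hk⟩ := hN.exists_inconsistent hA hR z hX
  obtain ⟨l, r, d, hdA, hdE⟩ := hE.exists_tuple_invariant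
  have hk0 : 0 < k := by
    rcases Nat.eq_zero_or_pos k with rfl | h
    · obtain ⟨x, hx⟩ := hX.1
      obtain ⟨i, -⟩ := hk (fun _ => z) (fun i => i.elim0) (fun i => i.elim0) x hx
      exact i.elim0
    · exact h
  refine ⟨l, r, d, hdA, k, hk0, fun Y hY hYc => ?_⟩
  rw [Set.eq_empty_iff_forall_notMem]
  intro x hx
  rw [Set.mem_iInter] at hx
  choose σ hσ hσY using hYc
  -- move the common point `x` into the set itself
  let τ : N ≃[L] N := (σ ⟨0, hk0⟩).symm
  have hτ : Fixes τ d.coords := (hσ _).symm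
  have hfib : ∀ i, fiber R (Tuple.mk t ((τ.comp (σ i)) ∘ z)) = Tuple.map τ '' Y i := by
    intro i
    rw [← Tuple.map_mk, ← fiber_map hR, Tuple.image_map_comp, ← hσY i]
  have hx0 : x.map τ ∈ fiber R (Tuple.mk t z) := by
    have := hx ⟨0, hk0⟩
    rwa [hσY, Tuple.mem_image_map] at this
  obtain ⟨i, hi⟩ := hk (fun i => (τ.comp (σ i)) ∘ z)
    (fun i => hdE _ (hτ.comp (hσ i)) z hzE) (fun i j hij => hY (by
      simp only [hfib] at hij
      exact (Set.image_injective.2 (Tuple.map_injective τ)) hij)) _ hx0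
  rw [hfib] at hi
  exact hi ⟨x, hx i, rfl⟩

/-- The canonical parameters of the instances of a zero-definable relation `R` form a sort. -/
theorem exists_canonical {R : Set (Tuple s × Tuple t)} (hR : ZeroDefinable R) :
    ∃ (S : EqSort L N) (f : RealVars t ≃ Fin S.arity)
      (R' : Set (Tuple s × Tuple (fun _ : Fin 1 => S))), ZeroDefinable R' ∧
      (∀ z : Fin S.arity → N, fiber R' (Tuple.single (S.cls z)) = fiber R (Tuple.mk t (z ∘ f))) ∧
      ∀ z z' : Fin S.arity → N,
        fiber R (Tuple.mk t (z ∘ f)) = fiber R (Tuple.mk t (z' ∘ f)) → S.cls z = S.cls z' := by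
  obtain ⟨a, ⟨f⟩⟩ := Finite.exists_equiv_fin (RealVars t)
  let S : EqSort L N :=
    { arity := a
      rel := Setoid.ker fun z : Fin a → N => fiber R (Tuple.mk t (z ∘ f))
      definable := zDef_fiber_eq hR (Sum.inl ∘ f) (Sum.inr ∘ f) }
  have hX : ZDef L {u : RealVars s ⊕ RealVars (fun _ : Fin 1 => S) → N |
      (Tuple.mk s (u ∘ Sum.inl), Tuple.mk t (fun k => u (Sum.inr ⟨0, f k⟩))) ∈ R} :=
    hR.preimage_comp
      (Sum.map id fun k => (⟨0, f k⟩ : RealVars (fun _ : Fin 1 => S)))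
  refine ⟨S, f, _, zeroDefinable_of_zDef hX, fun z => ?_, fun z z' h => Quotient.sound h⟩
  ext x
  constructor
  · rintro ⟨v, y, rfl, hy, hxy⟩
    have h : fiber R (Tuple.mk t fun k => y ⟨0, f k⟩) = fiber R (Tuple.mk t (z ∘ f)) :=
      Quotient.exact (congrFun hy 0)
    rw [← h]
    exact hxy
  · intro hx
    obtain ⟨v, rfl⟩ := x.exists_mk
    exact ⟨v, fun k => z k.2, rfl, rfl, hx⟩

/-- A definable set which is weakly normal relative to a small set `A ⊇ C` but not almost over `A`
is given by a formula, in its canonical parameter `e`, which thorn divides over `C`. -/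
theorem WeaklyNormal.exists_thornDivides (hN : IsMonster L N κ) {A C : Set (Imag L N)}
    (hA : #A < κ) (hCA : C ⊆ A) {R : Set (Tuple s × Tuple t)} (hR : ZeroDefinable R)
    (z : RealVars t → N) (hX : WeaklyNormal A (fiber R (Tuple.mk t z)))
    (hX' : ¬ AlmostOver A (fiber R (Tuple.mk t z))) :
    ∃ (S : EqSort L N) (f : RealVars t ≃ Fin S.arity)
      (R' : Set (Tuple s × Tuple (fun _ : Fin 1 => S))), ZeroDefinable R' ∧
      fiber R' (Tuple.single (S.cls (z ∘ f.symm))) = fiber R (Tuple.mk t z) ∧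
      ThornDivides C R' (Tuple.single (S.cls (z ∘ f.symm))) := by
  obtain ⟨S, f, R', hR', hfib, hinj⟩ := exists_canonical hR
  obtain ⟨l, r, d, hdA, k, hk0, hk⟩ := hX.exists_inconsistent hN hA
    ⟨n, t, _, R, Set.subset_univ _, hR, rfl⟩
  have he : fiber R' (Tuple.single (S.cls (z ∘ f.symm))) = fiber R (Tuple.mk t z) := by
    rw [hfib, Function.comp_assoc, Equiv.symm_comp_self, Function.comp_id]
  refine ⟨S, f, R', hR', he, l, r, d, fun hacl => hX' ?_, k, hk0, fun b hb hbc => ?_⟩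
  · have hfin : (orbit (C ∪ d.coords) (Tuple.single (S.cls (z ∘ f.symm)))).Finite :=
      finite_orbit_of_mem_acl (hacl ⟨0, rfl⟩)
    have := hfin.image (fiber R')
    rw [← conjugates_eq_image_orbit hR', he] at this
    exact this.subset (conjugates_mono (Set.union_subset hCA hdA) _)
  · refine hk (fun i => fiber R' (b i)) (fun i j hij => hb ?_) fun i => ?_
    · obtain ⟨σ, -, hσ⟩ := hbc i
      obtain ⟨τ, -, hτ⟩ := hbc j
      simp only [hσ, hτ] at hij ⊢
      exact funext fun _ => hinj _ _ ((hfib _).symm.trans (hij.trans (hfib _)))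
    · obtain ⟨σ, hσ, hσb⟩ := hbc i
      refine ⟨σ, hσ.mono Set.subset_union_right, ?_⟩
      rw [hσb, ← fiber_map hR', he]

/-- A consistent formula `φ(x, b)` which strongly divides over the small set `A` defines a set
which is weakly normal relative to `A` and not almost over `A`. -/
theorem StronglyDivides.weaklyNormal_and_not_almostOver (hN : IsMonster L N κ)
    {A : Set (Imag L N)} (hA : #A < κ) {R : Set (Tuple s × Tuple t)} (hR : ZeroDefinable R)
    {b : Tuple t} (h : StronglyDivides A R b) (hne : (fiber R b).Nonempty) :
    WeaklyNormal A (fiber R b) ∧ ¬ AlmostOver A (fiber R b) := by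
  obtain ⟨hacl, k, -, hk⟩ := h
  -- a point satisfies fewer than `k` of the conjugate formulas
  have hfin : ∀ x, {b' ∈ orbit A b | x ∈ fiber R b'}.Finite := by
    intro x
    by_contra hinf
    let g := Set.Infinite.natEmbedding _ hinf
    have := hk (fun i => (g i).1) (fun i j hij => Fin.ext (g.injective (Subtype.ext hij)))
      (fun i => (g i).2.1)
    have hx : x ∈ ⋂ i : Fin k, fiber R (g i).1 := Set.mem_iInter.2 fun i => (g i).2.2
    rw [this] at hx
    exact hx
  refine ⟨⟨hne, fun x _ => ?_⟩, fun halm => hacl (hN.coords_subset_acl hA ?_)⟩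
  · rw [conjugates_eq_image_orbit hR]
    refine ((hfin x).image (fiber R)).subset ?_
    rintro _ ⟨⟨b', hb', rfl⟩, hx⟩
    exact ⟨b', ⟨hb', hx⟩, rfl⟩
  · have hne' : ∀ Y ∈ conjugates A (fiber R b), ∃ x, x ∈ Y := by
      rintro _ ⟨σ, -, rfl⟩
      exact hne.image _
    rw [AlmostOver] at halm
    have : Nonempty (Tuple s) := ⟨hne.some⟩
    choose! x hx using hne'
    refine (halm.biUnion fun Y _ => hfin (x Y)).subset fun b' hb' => ?_
    have hY : fiber R b' ∈ conjugates A (fiber R b) := by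
      rw [conjugates_eq_image_orbit hR]
      exact ⟨b', hb', rfl⟩
    exact Set.mem_iUnion₂.2 ⟨_, hY, hb', hx _ hY⟩

end ThornDividing

/-! ### Dividing and forking -/

section Forking

variable {L : FirstOrder.Language.{u, v}} {N : Type w} [L.Structure N]
variable {m : ℕ} {s : Fin m → EqSort L N} {κ : Cardinal.{w}}

theorem Divides.forks {A : Set (Imag L N)} {X : Set (Tuple s)} (hX : IsDefinable X)
    (h : Divides A X) : Forks A X :=
  ⟨1, fun _ => X, fun _ => ⟨hX, h⟩, Set.subset_iUnion (fun _ : Fin 1 => X) 0⟩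

/-- A weakly normal set which is not almost over `A` divides over `A`, as witnessed by any sequence
of distinct conjugates. -/
theorem WeaklyNormal.divides (hN : IsMonster L N κ) {A : Set (Imag L N)} (hA : #A < κ)
    {X : Set (Tuple s)} (hd : IsDefinable X) (hX : WeaklyNormal A X) (hX' : ¬ AlmostOver A X) :
    Divides A X := by
  obtain ⟨l, r, d, hdA, k, hk0, hk⟩ := hX.exists_inconsistent hN hA hd
  let Y := Set.Infinite.natEmbedding _ hX'
  refine ⟨fun i => (Y i).1, fun i => (Y i).2, k, hk0, fun I hI => ?_⟩
  have h := hk (fun i => (Y (I.equivFinOfCardEq hI |>.symm i)).1) (fun i j hij =>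
    (I.equivFinOfCardEq hI).symm.injective (Subtype.ext (Y.injective (Subtype.ext hij))))
    fun i => conjugates_mono hdA X (Y _).2
  rw [Set.eq_empty_iff_forall_notMem] at h ⊢
  exact fun x hx => h x (Set.mem_iInter.2 fun i => Set.mem_iInter₂.1 hx _ (Subtype.mem _))

theorem Forks.of_mem_conjugates {A : Set (Imag L N)} {X Y : Set (Tuple s)} (h : Forks A X)
    (hY : Y ∈ conjugates A X) : Forks A Y := by
  obtain ⟨l, Z, hZ, hXZ⟩ := h
  obtain ⟨σ, hσ, rfl⟩ := hY
  refine ⟨l, fun j => Tuple.map σ '' Z j, fun j => ⟨(hZ j).1.image_map σ,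
    (hZ j).2.of_mem_conjugates ⟨σ, hσ, rfl⟩⟩, ?_⟩
  rw [← Set.image_iUnion]
  exact Set.image_mono hXZ

theorem Forks.sUnion {A : Set (Imag L N)} {F : Set (Set (Tuple s))} (hF : F.Finite)
    (h : ∀ X ∈ F, Forks A X) : Forks A (⋃₀ F) := by
  have : Finite F := hF
  choose l Z hZ hXZ using fun X : F => h X X.2
  obtain ⟨n, ⟨e⟩⟩ := Finite.exists_equiv_fin (Σ X : F, Fin (l X))
  refine ⟨n, fun i => Z (e.symm i).1 (e.symm i).2, fun i => hZ _ _, ?_⟩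
  rintro x ⟨X, hX, hx⟩
  obtain ⟨j, hj⟩ := Set.mem_iUnion.1 (hXZ ⟨X, hX⟩ hx)
  obtain ⟨i, hi⟩ := e.symm.surjective ⟨⟨X, hX⟩, j⟩
  exact Set.mem_iUnion.2 ⟨i, by rw [hi]; exact hj⟩

/-- If no nonempty `A`-definable set forks over `A`, a definable set which is almost over `A` does
not fork over `A`: otherwise the union of its conjugates, an `A`-definable set, would fork. -/
theorem AlmostOver.not_forks (hN : IsMonster L N κ) {A : Set (Imag L N)} (hA : #A < κ)
    {X : Set (Tuple s)} (hd : IsDefinable X) (hX : X.Nonempty) (h : AlmostOver A X)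
    (hfork : ∀ Y : Set (Tuple s), DefinableOver A Y → Y.Nonempty → ¬ Forks A Y) :
    ¬ Forks A X := by
  intro hXf
  refine hfork (⋃₀ conjugates A X) ?_ ?_ (Forks.sUnion h fun Y hY => hXf.of_mem_conjugates hY)
  · have hdef : ∀ Y ∈ conjugates A X, ∃ B : Set (Imag L N), B.Finite ∧ DefinableOver B Y := by
      rintro _ ⟨σ, -, rfl⟩
      obtain ⟨l, r, c, R, -, hR, hY⟩ := hd.image_map σ
      exact ⟨c.coords, c.finite_coords, l, r, c, R, subset_rfl, hR, hY⟩
    choose! B hB hBY using hdef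
    rw [AlmostOver] at h
    refine hN.definableOver_of_invariant hA
      (hN.lt_of_finite (h.biUnion fun Y hY => hB Y hY)) (DefinableOver.sUnion h fun Y hY =>
        (hBY Y hY).mono (Set.subset_biUnion_of_mem hY)) ?_
    rintro σ hσ x ⟨Y, hY, hx⟩
    exact ⟨_, conjugates_trans hY ⟨σ, hσ, rfl⟩, x, hx, rfl⟩
  · obtain ⟨x, hx⟩ := hX
    exact ⟨x, X, mem_conjugates_self A X, hx⟩

end Forking

/-! ### Closing a set under an operation on small subsets -/

section Closure

theorem mk_iUnion_le_of_le {α ι : Type w} {c : Cardinal.{w}} (hc : ℵ₀ ≤ c) {f : ι → Set α}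
    (hι : #ι ≤ c) (hf : ∀ i, #(f i) ≤ c) : #(⋃ i, f i) ≤ c :=
  (Cardinal.mk_iUnion_le f).trans (Cardinal.mul_le_of_le hc hι (ciSup_le' hf))

/-- A set of cardinality at most `2 ^ c` is contained in another one which is closed under an
operation on subsets of cardinality at most `c`. It is the union of a chain of length `c⁺`. -/
theorem exists_closed_superset {α : Type w} {c : Cardinal.{w}} (hc : ℵ₀ ≤ c)
    (U : Set α → Set α) (hU : ∀ A : Set α, #A ≤ c → #(U A) ≤ 2 ^ c) (B : Set α) (hB : #B ≤ 2 ^ c) :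
    ∃ M : Set α, B ⊆ M ∧ #M ≤ 2 ^ c ∧ ∀ A ⊆ M, #A ≤ c → U A ⊆ M := by
  have hc2 : c ≤ 2 ^ c := (Cardinal.cantor c).le
  have hc2' : ℵ₀ ≤ 2 ^ c := hc.trans hc2
  let I := (Order.succ c).ord.ToType
  let step : Set α → Set α := fun P => B ∪ ⋃ A : {A : Set α // A ⊆ P ∧ #A ≤ c}, U A
  let F : I → Set α := wellFounded_lt.fix fun i ih => step (⋃ j : Set.Iio i, ih j j.2)
  have hF : ∀ i, F i = step (⋃ j : Set.Iio i, F j) := fun i => WellFounded.fix_eq _ _ i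
  have hcard : ∀ i, #(F i) ≤ 2 ^ c := by
    intro i
    refine wellFounded_lt.induction (C := fun i => #(F i) ≤ 2 ^ c) i fun i ih => ?_
    rw [hF i]
    have hP : #(⋃ j : Set.Iio i, F j) ≤ 2 ^ c := by
      refine mk_iUnion_le_of_le hc2' (le_trans ?_ hc2) fun j => ih j j.2
      have := Cardinal.mk_Iio_lt i (by simp [I])
      rw [Cardinal.mk_ord_toType] at this
      exact Order.lt_succ_iff.1 this
    refine (Cardinal.mk_union_le _ _).trans (Cardinal.add_le_of_le hc2' hB ?_)
    refine mk_iUnion_le_of_le hc2' ?_ fun A => hU A A.2.2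
    refine (Cardinal.mk_bounded_subset_le _ c).trans ?_
    calc _ ≤ ((2 : Cardinal) ^ c) ^ c := Cardinal.power_le_power_right (max_le hP hc2')
      _ = 2 ^ c := by rw [← Cardinal.power_mul, Cardinal.mul_eq_self hc]
  refine ⟨⋃ i, F i, ?_, mk_iUnion_le_of_le hc2' ?_ hcard, fun A hA hAc => ?_⟩
  · have hne : Nonempty I := by
      rw [← Cardinal.mk_ne_zero_iff, Cardinal.mk_ord_toType]
      exact (pos_of_gt (Order.lt_succ c)).ne'
    obtain ⟨i⟩ := hne
    refine fun x hx => Set.mem_iUnion.2 ⟨i, ?_⟩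
    rw [hF i]
    exact Or.inl hx
  · rw [Cardinal.mk_ord_toType]
    exact Order.succ_le_of_lt (Cardinal.cantor c)
  · choose i hi using fun a : A => Set.mem_iUnion.1 (hA a.2)
    obtain ⟨j, hj⟩ : ∃ j, ∀ a, i a < j := by
      by_contra! hcon
      have hcof : IsCofinal (Set.range i) := fun j => by
        obtain ⟨a, ha⟩ := hcon j
        exact ⟨_, ⟨a, rfl⟩, ha⟩
      have h1 := Order.cof_le hcof
      rw [Ordinal.cof_toType, (Cardinal.isRegular_succ hc).cof_ord] at h1
      exact (h1.trans (Cardinal.mk_range_le.trans hAc)).not_gt (Order.lt_succ c)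
    refine fun x hx => Set.mem_iUnion.2 ⟨j, ?_⟩
    rw [hF j]
    refine Or.inr (Set.mem_iUnion.2 ⟨⟨A, fun a ha => ?_, hAc⟩, hx⟩)
    exact Set.mem_iUnion.2 ⟨⟨i ⟨a, ha⟩, hj _⟩, hi ⟨a, ha⟩⟩

end Closure

/-! ### Small saturated elementary substructures -/

section Submodel

variable {L : FirstOrder.Language.{u, v}} {N : Type w} [L.Structure N]
variable {m : ℕ} {s : Fin m → EqSort L N} {κ : Cardinal.{w}}

theorem IsMonster.exists_card_eq (hN : IsMonster L N κ) :
    ∃ c < κ, Cardinal.lift.{max u v} c = Cardinal.lift.{w} L.card :=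
  Cardinal.lt_lift_iff.1 hN.card_lt

theorem mk_formula_le {c : Cardinal.{w}} (hc : ℵ₀ ≤ c)
    (hL : Cardinal.lift.{w} L.card ≤ Cardinal.lift.{max u v} c) {α : Type w} (hα : #α ≤ c) :
    #(L.Formula α) ≤ Cardinal.lift.{max u v} c := by
  have h1 : #(L.Formula α) ≤ #(Σ n, L.BoundedFormula α n) :=
    Cardinal.mk_le_of_injective (f := fun φ => (⟨0, φ⟩ : Σ n, L.BoundedFormula α n))
      fun φ ψ h => by simpa using h
  have hc' : ℵ₀ ≤ Cardinal.lift.{max u v} c := Cardinal.aleph0_le_lift.2 hc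
  refine h1.trans (FirstOrder.Language.BoundedFormula.card_le.trans (max_le hc' ?_))
  exact Cardinal.add_le_of_le hc' (Cardinal.lift_le.2 hα) hL

/-- The relation of having the same type over the subset `A` of `N`, on real `n`-tuples. -/
def sameType (L : FirstOrder.Language.{u, v}) {N : Type w} [L.Structure N] (A : Set N) (n : ℕ) :
    Setoid (Fin n → N) :=
  Setoid.ker fun x => {φ : L.Formula (A ⊕ Fin n) | φ.Realize (Sum.elim (fun a : A => (a : N)) x)}

theorem mk_quotient_sameType_le {c : Cardinal.{w}} (hc : ℵ₀ ≤ c)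
    (hL : Cardinal.lift.{w} L.card ≤ Cardinal.lift.{max u v} c) {A : Set N} (hA : #A ≤ c) (n : ℕ) :
    #(Quotient (sameType L A n)) ≤ 2 ^ c := by
  let g : Quotient (sameType L A n) → Set (L.Formula (A ⊕ Fin n)) :=
    Quotient.lift (fun x => {φ | φ.Realize (Sum.elim (fun a : A => (a : N)) x)}) fun _ _ h => h
  have hg : Function.Injective g := by
    intro p q
    induction p using Quotient.inductionOn
    induction q using Quotient.inductionOn
    exact fun h => Quotient.sound h
  have hα : #(A ⊕ Fin n) ≤ c := by
    rw [Cardinal.mk_sum, Cardinal.lift_uzero]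
    exact Cardinal.add_le_of_le hc hA (le_trans (by simp) hc)
  have h1 := Cardinal.lift_mk_le_lift_mk_of_injective hg
  have h2 : #(Set (L.Formula (A ⊕ Fin n))) ≤ Cardinal.lift.{max u v} (2 ^ c) := by
    rw [Cardinal.mk_set, Cardinal.lift_power, Cardinal.lift_two]
    exact Cardinal.power_le_power_left two_ne_zero (mk_formula_le hc hL hα)
  have h3 := h1.trans (Cardinal.lift_le.2 h2)
  rw [Cardinal.lift_lift] at h3
  exact Cardinal.lift_le.1 h3

/-- The coordinates of representatives of all the types of finite tuples over `A`. -/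
def typeReps (L : FirstOrder.Language.{u, v}) {N : Type w} [L.Structure N] (A : Set N) : Set N :=
  ⋃ n : ℕ, ⋃ q : Quotient (sameType L A n), Set.range q.out

theorem mk_typeReps_le {c : Cardinal.{w}} (hc : ℵ₀ ≤ c)
    (hL : Cardinal.lift.{w} L.card ≤ Cardinal.lift.{max u v} c) {A : Set N} (hA : #A ≤ c) :
    #(typeReps L A) ≤ 2 ^ c := by
  have hc2' : ℵ₀ ≤ 2 ^ c := hc.trans (Cardinal.cantor c).le
  have h : typeReps L A = ⋃ n : ULift.{w} ℕ, ⋃ q : Quotient (sameType L A n.down),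
      Set.range q.out := by
    ext x
    simp [typeReps]
  rw [h]
  refine mk_iUnion_le_of_le hc2' (by simpa using hc2') fun n =>
    mk_iUnion_le_of_le hc2' (mk_quotient_sameType_le hc hL hA n.down) fun q => ?_
  exact (Cardinal.lt_aleph0_iff_set_finite.2 (Set.finite_range _)).le.trans hc2'

/-- Every tuple has the same type over `A` as some tuple from `typeReps L A`. -/
theorem exists_mem_typeReps (A : Set N) {n : ℕ} (x : Fin n → N) :
    ∃ x' : Fin n → N, (∀ i, x' i ∈ typeReps L A) ∧ ∀ X : Set (A ⊕ Fin n → N), ZDef L X →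
      Sum.elim (fun a : A => (a : N)) x ∈ X → Sum.elim (fun a : A => (a : N)) x' ∈ X := by
  let q : Quotient (sameType L A n) := Quotient.mk _ x
  refine ⟨q.out, fun i => Set.mem_iUnion.2 ⟨n, Set.mem_iUnion.2 ⟨q, i, rfl⟩⟩, ?_⟩
  intro X hX hx
  obtain ⟨φ, rfl⟩ := Set.empty_definable_iff.1 hX
  have h : (sameType L A n) q.out x := Quotient.exact q.out_eq
  have := Set.ext_iff.1 h φ
  exact this.2 hx

/-- A formula with parameters holds in a structure if and only if the corresponding formula
without parameters holds of the parameters. -/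
theorem realize_constantsVarsEquiv' {A : Set N} {α : Type*} (φ : L[[A]].Formula α) (x : α → N) :
    FirstOrder.Language.Formula.Realize (FirstOrder.Language.BoundedFormula.constantsVarsEquiv φ)
      (Sum.elim (fun a : A => (a : N)) x) ↔ φ.Realize x := by
  simp only [FirstOrder.Language.Formula.Realize]
  rw [← FirstOrder.Language.BoundedFormula.realize_constantsVarsEquiv]
  rfl

/-- A small saturated elementary substructure of a monster model, containing a given small set. -/
theorem IsMonster.exists_saturated (hN : IsMonster L N κ) {c : Cardinal.{w}} (hcκ : c < κ)
    (B : Set N) (hB : #B < κ) :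
    ∃ M : L.ElementarySubstructure N, #M < κ ∧ B ⊆ M ∧ ∀ μ ≤ Order.succ (max ℵ₀ c),
      IsSaturated L M μ := by
  obtain ⟨cL, hcL, hL⟩ := hN.exists_card_eq
  let c' := max (max ℵ₀ c) (max #B cL)
  have hc' : ℵ₀ ≤ c' := (le_max_left _ _).trans (le_max_left _ _)
  have hc'κ : c' < κ := max_lt (max_lt hN.aleph0_lt hcκ) (max_lt hB hcL)
  have hL' : Cardinal.lift.{w} L.card ≤ Cardinal.lift.{max u v} c' := by
    rw [← hL, Cardinal.lift_le]
    exact (le_max_right _ _).trans (le_max_right _ _)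
  obtain ⟨M, hBM, hMc, hM⟩ := exists_closed_superset hc' (typeReps L)
    (fun A hA => mk_typeReps_le hc' hL' hA) B
    (((le_max_left _ _).trans (le_max_right _ _)).trans (Cardinal.cantor c').le)
  -- the Tarski-Vaught test
  have hmeets : L.MeetsDefinable M := by
    rintro D ⟨d, hd⟩ hD
    obtain ⟨A₀, hA₀, hD⟩ := Set.definable_iff_finitely_definable.1 hD
    obtain ⟨φ, hφ⟩ := Set.definable_iff_exists_formula_sum.1 hD
    obtain ⟨x', hx', h⟩ := exists_mem_typeReps (L := L) (A₀ : Set N) (fun _ : Fin 1 => d)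
    refine ⟨x' 0, ?_, hM _ hA₀ ((Cardinal.lt_aleph0_iff_set_finite.2
      A₀.finite_toSet).le.trans hc') (hx' 0)⟩
    have h1 := h {v | φ.Realize v} (zDef_setOf_realize φ) ((Set.ext_iff.1 hφ _).1 hd)
    exact (Set.ext_iff.1 hφ x').2 h1
  have hcl := hmeets.closure_eq_self
  let M' := hmeets.toElementarySubstructure
  have hM' : (M' : Set N) = M := hcl
  refine ⟨M', ?_, hM'.symm ▸ hBM, ?_⟩
  · have : #M' = #M := congrArg (fun S : Set N => #S) hM'
    rw [this]
    exact hMc.trans_lt (hN.isStrongLimit.isStrongPrelimit hc'κ)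
  · intro μ hμ A hA n Γ hΓ
    have hAc : #A ≤ c' :=
      (Order.lt_succ_iff.1 (hA.trans_le hμ)).trans (le_max_left _ _)
    let f : L[[A]].Formula (Fin n) → Set (A ⊕ Fin n → N) := fun φ =>
      {v | FirstOrder.Language.Formula.Realize
        (FirstOrder.Language.BoundedFormula.constantsVarsEquiv φ) v}
    let y : A → N := fun a => ((a : M') : N)
    have hf : ∀ φ (x : Fin n → M'), Sum.elim y (fun i => (x i : N)) ∈ f φ ↔ φ.Realize x := by
      intro φ x
      rw [← realize_constantsVarsEquiv', ← M'.subtype.map_formula, Sum.comp_elim]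
      rfl
    have hy : ∀ a, y a ∈ M := fun a => hM' ▸ (a : M').2
    have hyc : #(Set.range y) ≤ c' := Cardinal.mk_range_le.trans hAc
    have hfZ : ∀ φ, ZDef L (f φ) := fun φ => zDef_setOf_realize _
    obtain ⟨x, hx⟩ := hN.saturated.exists_mem y (hyc.trans_lt hc'κ) (f '' Γ)
      (by rintro _ ⟨φ, -, rfl⟩; exact hfZ φ) (by
        intro F hF hFf
        have : Finite F := hFf
        choose φ hφ hφF using fun Z : F => hF Z.2
        obtain ⟨x, hx⟩ := hΓ (Set.finite_range φ).toFinset (by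
          rw [Set.Finite.coe_toFinset]
          rintro _ ⟨Z, rfl⟩
          exact hφ Z)
        refine ⟨fun i => x i, fun Z hZ => ?_⟩
        rw [← show f (φ ⟨Z, hZ⟩) = Z from hφF ⟨Z, hZ⟩, hf]
        exact hx _ (by simp))
    -- `x` realizes the type in `N`; some tuple `x'` from `M` has the same type as `x`
    obtain ⟨x', hx', h⟩ := exists_mem_typeReps (L := L) (Set.range y) x
    have hx'M : ∀ i, x' i ∈ M' := fun i => by
      have : x' i ∈ M := hM _ (Set.range_subset_iff.2 hy) hyc (hx' i)
      rw [← hM'] at this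
      exact this
    refine ⟨fun i => ⟨x' i, hx'M i⟩, fun φ hφ => (hf φ _).1 ?_⟩
    have hcomp : ∀ z : Fin n → N, Sum.elim (fun a : Set.range y => (a : N)) z ∘
        Sum.map (Set.rangeFactorization y) id = Sum.elim y z := fun z => by
      rw [Sum.elim_comp_map]
      rfl
    have h1 := h _ ((hfZ φ).preimage_comp (Sum.map (Set.rangeFactorization y) id)) (by
      rw [Set.mem_preimage, hcomp]
      exact hx _ ⟨φ, hφ, rfl⟩)
    rw [Set.mem_preimage, hcomp] at h1
    exact h1

/-- There are at most as many sorts as formulas. -/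
theorem mk_eqSort_le {c : Cardinal.{w}} (hc : ℵ₀ ≤ c)
    (hL : Cardinal.lift.{w} L.card ≤ Cardinal.lift.{max u v} c) : #(EqSort L N) ≤ c := by
  choose φ hφ using fun S : EqSort L N => Set.empty_definable_iff.1 S.definable
  let g : EqSort L N → Σ n : ULift.{w} ℕ, L.Formula (ULift.{w} (Fin n.down ⊕ Fin n.down)) :=
    fun S => ⟨⟨S.arity⟩, (φ S).relabel ULift.up⟩
  have hg : Function.Injective g := by
    intro S T h
    have key : ∀ (S : EqSort L N) (x y : Fin S.arity → N), S.rel x y ↔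
        ((φ S).relabel ULift.up : L.Formula (ULift.{w} (Fin S.arity ⊕ Fin S.arity))).Realize
          fun i => Sum.elim x y i.down := by
      intro S x y
      rw [FirstOrder.Language.Formula.realize_relabel]
      exact Set.ext_iff.1 (hφ S) (Sum.elim x y)
    have key' := And.intro (key S) (key T)
    obtain ⟨n, r, hr⟩ := S
    obtain ⟨n', r', hr'⟩ := T
    obtain rfl : n = n' := congrArg ULift.down (Sigma.mk.inj h).1
    have h' := eq_of_heq (Sigma.mk.inj h).2
    obtain rfl : r = r' := by
      ext x y
      rw [key'.1 x y, key'.2 x y]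
      dsimp only at h' ⊢
      rw [h']
    rfl
  have h1 := Cardinal.lift_mk_le_lift_mk_of_injective hg
  have hc' : ℵ₀ ≤ Cardinal.lift.{max u v} c := Cardinal.aleph0_le_lift.2 hc
  have h2 : #(Σ n : ULift.{w} ℕ, L.Formula (ULift.{w} (Fin n.down ⊕ Fin n.down))) ≤
      Cardinal.lift.{max u v} c := by
    rw [Cardinal.mk_sigma]
    refine (Cardinal.sum_le_lift_mk_mul_iSup _).trans
      (Cardinal.mul_le_of_le hc' ((Cardinal.lift_le_aleph0.2 Cardinal.mk_le_aleph0).trans hc')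
        (ciSup_le' fun n => mk_formula_le hc hL ?_))
    exact le_trans (Cardinal.lt_aleph0_of_finite _).le hc
  have h3 := h1.trans (Cardinal.lift_le.2 h2)
  rw [Cardinal.lift_lift] at h3
  exact Cardinal.lift_le.1 h3

/-- `M^eq` is small if `M` is, as the language is small. -/
theorem IsMonster.mk_eqPart_lt (hN : IsMonster L N κ) {M : L.ElementarySubstructure N}
    (hM : #M < κ) : #(eqPart M) < κ := by
  obtain ⟨cL, hcL, hL⟩ := hN.exists_card_eq
  let c := max (max ℵ₀ #M) cL
  have hc : ℵ₀ ≤ c := (le_max_left _ _).trans (le_max_left _ _)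
  have hcκ : c < κ := max_lt (max_lt hN.aleph0_lt hM) hcL
  have hL' : Cardinal.lift.{w} L.card ≤ Cardinal.lift.{max u v} c := by
    rw [← hL, Cardinal.lift_le]
    exact le_max_right _ _
  let g : (Σ S : EqSort L N, Fin S.arity → M) → Imag L N := fun p => ⟨p.1, p.1.cls fun i => p.2 i⟩
  have hg : eqPart M ⊆ Set.range g := by
    rintro ⟨S, e⟩ ⟨v, hv, he⟩
    exact ⟨⟨S, fun i => ⟨v i, hv i⟩⟩, congrArg (fun x => (⟨S, x⟩ : Imag L N)) he⟩
  refine lt_of_le_of_lt ?_ hcκ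
  refine (Cardinal.mk_le_mk_of_subset hg).trans (Cardinal.mk_range_le.trans ?_)
  rw [Cardinal.mk_sigma]
  refine (Cardinal.sum_le_mk_mul_iSup _).trans
    (Cardinal.mul_le_of_le hc (mk_eqSort_le hc hL') (ciSup_le' fun S => ?_))
  rw [Cardinal.mk_arrow, Cardinal.lift_uzero, Cardinal.mk_fin, Cardinal.lift_natCast]
  exact Cardinal.power_nat_le_max.trans
    (max_le ((le_max_right _ _).trans (le_max_left _ _)) hc)

/-- Finite tuples can be moved into a saturated elementary substructure, over a set of parameters
from it. -/
theorem IsMonster.exists_fixes_mem (hN : IsMonster L N κ) {M : L.ElementarySubstructure N}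
    {C D : Set (Imag L N)} (hM : IsSaturated L M (max ℵ₀ (Order.succ #C))) (hCκ : #C < κ)
    (hC : C ⊆ eqPart M) (hD : D ⊆ eqPart M) (hDf : D.Finite) {ι : Type} [Finite ι] (v : ι → N) :
    ∃ σ : N ≃[L] N, Fixes σ (C ∪ D) ∧ ∀ i, σ (v i) ∈ M := by
  have hCDκ := hN.mk_paramVars_lt (hN.union_lt hCκ (hN.lt_of_finite hDf))
  choose z hzM hz using fun e : (C ∪ D : Set (Imag L N)) => Set.union_subset hC hD e.2
  let y₀ : ParamVars (C ∪ D) → M := fun k => ⟨z k.1 k.2, hzM k.1 k.2⟩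
  let y : ParamVars (C ∪ D) → N := M.subtype ∘ y₀
  have hy : y ∈ Reps (C ∪ D) := hz
  have hcard : #(ParamVars (C ∪ D)) < max ℵ₀ (Order.succ #C) := by
    rcases C.finite_or_infinite with hCf | hCi
    · have : Finite (C ∪ D : Set (Imag L N)) := hCf.union hDf
      exact lt_max_of_lt_left (Cardinal.lt_aleph0_of_finite _)
    · have hC0 : ℵ₀ ≤ #C := Cardinal.infinite_iff.1 hCi.to_subtype
      refine lt_max_of_lt_right (Order.lt_succ_iff.2 ((mk_paramVars_le _).trans ?_))
      refine Cardinal.mul_le_of_le hC0 ((Cardinal.mk_union_le _ _).trans ?_) hC0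
      exact Cardinal.add_le_of_le hC0 le_rfl
        ((Cardinal.lt_aleph0_iff_set_finite.2 hDf).le.trans hC0)
  -- the type of `v` over the parameters `y`, in the structure `M`
  obtain ⟨x, hx⟩ := hM.exists_mem y₀ (Cardinal.mk_range_le.trans_lt hcard)
    {Z | ∃ φ : L.Formula (ParamVars (C ∪ D) ⊕ ι),
      Z = {u | φ.Realize u} ∧ φ.Realize (Sum.elim y v)}
    (by rintro _ ⟨φ, rfl, -⟩; exact zDef_setOf_realize φ) (by
      intro F hF hFf
      have : Finite F := hFf
      choose φ hφF hφ using fun Z : F => hF Z.2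
      let ψ : L.Formula (ParamVars (C ∪ D)) := (FirstOrder.Language.Formula.iInf φ).iExs ι
      have hψ : ψ.Realize y := by
        rw [FirstOrder.Language.Formula.realize_iExs]
        exact ⟨v, FirstOrder.Language.Formula.realize_iInf.2 hφ⟩
      rw [M.subtype.map_formula, FirstOrder.Language.Formula.realize_iExs] at hψ
      obtain ⟨x, hx⟩ := hψ
      refine ⟨x, fun Z hZ => ?_⟩
      rw [show Z = _ from hφF ⟨Z, hZ⟩]
      exact FirstOrder.Language.Formula.realize_iInf.1 hx _)
  obtain ⟨σ, hσ⟩ := hN.exists_aut (J := ParamVars (C ∪ D) ⊕ ι) (by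
      rw [Cardinal.mk_sum, Cardinal.lift_uzero, Cardinal.lift_id, Cardinal.lift_id]
      exact Cardinal.add_lt_of_lt hN.aleph0_lt.le hCDκ
        (lt_of_lt_of_le (by simp) hN.aleph0_lt.le))
    (Sum.elim y v) (Sum.elim y (M.subtype ∘ x)) (by
      intro X hX hyX
      obtain ⟨φ, rfl⟩ := Set.empty_definable_iff.1 hX
      have := hx _ ⟨φ, rfl, hyX⟩
      rw [Set.mem_ofPred_eq, ← M.subtype.map_formula, Sum.comp_elim] at this
      exact this)
  have hσy : σ ∘ y = y := funext fun k => hσ (.inl k)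
  refine ⟨σ, Reps.fixes hy (hσy.symm ▸ hy), fun i => ?_⟩
  rw [show σ (v i) = x i from hσ (.inr i)]
  exact (x i).2

end Submodel

/-! ### Thorn forking and types over saturated models -/

section MainDirections

variable {L : FirstOrder.Language.{u, v}} {N : Type w} [L.Structure N]
variable {m n : ℕ} {s : Fin m → EqSort L N} {t : Fin n → EqSort L N} {κ : Cardinal.{w}}

/-- If `tp(a/M)` does not thorn divide over `C`, then the sets of `tp(a/M)` which are weakly normal
relative to `C' ⊇ C` are almost over `C'`. -/
theorem IsMonster.almostOver_of_not_thornDivides (hN : IsMonster L N κ)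
    {M : L.ElementarySubstructure N} (hM : #M < κ) {C : Set (Imag L N)} {a : Tuple s}
    (ha : ¬ (tp a (eqPart M)).ThornDivides C) {X : Set (Tuple s)} (hX : X ∈ (tp a (eqPart M)).sets)
    {C' : Set (Imag L N)} (hC : C ⊆ C') (hC' : C' ⊆ eqPart M) (hw : WeaklyNormal C' X) :
    AlmostOver C' X := by
  by_contra hal
  obtain ⟨⟨l, r, c, R, hc, hR, rfl⟩, haX⟩ := hX
  obtain ⟨z, hz, rfl⟩ : ∃ z : RealVars r → N, (∀ k, z k ∈ M) ∧ Tuple.mk r z = c := by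
    choose z hz hzc using fun i => hc ⟨i, rfl⟩
    exact ⟨fun k => z k.1 k.2, fun k => hz _ _, funext hzc⟩
  obtain ⟨S, f, R', hR', he, hdiv⟩ := hw.exists_thornDivides hN
    ((Cardinal.mk_le_mk_of_subset hC').trans_lt (hN.mk_eqPart_lt hM)) hC hR _ hal
  have hcoords : (Tuple.single (S.cls (z ∘ f.symm))).coords ⊆ eqPart M := by
    rintro _ ⟨-, rfl⟩
    exact ⟨_, fun i => hz _, rfl⟩
  exact ha ⟨1, _, _, R', hcoords, hR', ⟨⟨1, _, _, R', hcoords, hR', rfl⟩, by rwa [he]⟩, hdiv⟩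

/-- A type `p` over a sufficiently saturated model `M`, all of whose weakly normal sets relative to
`C' ⊇ C` are almost over `C'`, extends to any small set without thorn dividing over `C`. -/
theorem IsMonster.exists_not_thornDivides (hN : IsMonster L N κ)
    {M : L.ElementarySubstructure N} (hM : #M < κ) {C : Set (Imag L N)} (hCκ : #C < κ)
    (hsat : IsSaturated L M (max ℵ₀ (Order.succ #C))) (hC : C ⊆ eqPart M)
    (p : CompleteType (eqPart M) s)
    (hp : ∀ X ∈ p.sets, ∀ C' : Set (Imag L N), C ⊆ C' → C' ⊆ eqPart M →
      WeaklyNormal C' X → AlmostOver C' X)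
    {B : Set (Imag L N)} (hB : #B < κ) :
    ∃ a : Tuple s, (∀ X ∈ p.sets, a ∈ X) ∧ ¬ (tp a B).ThornDivides C := by
  classical
  let T : Set (Set (Tuple s)) := {Z | ∃ (n : ℕ) (t : Fin n → EqSort L N) (b : Tuple t)
    (R : Set (Tuple s × Tuple t)), b.coords ⊆ B ∧ ZeroDefinable R ∧ Z = (fiber R b)ᶜ ∧
      ThornDivides C R b}
  have hTB : ∀ Z ∈ T, DefinableOver B Z := by
    rintro _ ⟨n, t, b, R, hb, hR, rfl, -⟩
    exact DefinableOver.compl ⟨n, t, b, R, hb, hR, rfl⟩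
  obtain ⟨a, ha⟩ := hN.exists_tuple_mem (hN.union_lt (hN.mk_eqPart_lt hM) hB) (p.sets ∪ T) (by
      rintro Z (hZ | hZ)
      · exact (p.definable Z hZ).mono Set.subset_union_left
      · exact (hTB Z hZ).mono Set.subset_union_right) (by
    intro F hF hFf
    by_contra hemp
    -- a set `X` in `p` is covered by finitely many instances which thorn divide over `C`
    obtain ⟨l, r, c, R₀, hc, hR₀, hX⟩ := DefinableOver.sInter
      (hFf.subset (Set.inter_subset_left (t := p.sets))) fun Z hZ => p.definable Z hZ.2
    have : Finite (F ∩ T : Set (Set (Tuple s))) := hFf.subset Set.inter_subset_left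
    choose n t b R hb hR hZ k q d hdiv using fun Z : (F ∩ T : Set (Set (Tuple s))) => Z.2.2
    choose vb hvb using fun Z => (b Z).exists_mk
    choose vd hvd using fun Z => (d Z).exists_mk
    -- move their parameters into `M`, over `C` and the parameters of `X`
    obtain ⟨σ, hσ, hσM⟩ := hN.exists_fixes_mem hsat hCκ hC hc c.finite_coords
      (fun i : (Σ Z : Fin (Nat.card (F ∩ T : Set (Set (Tuple s)))),
        (RealVars (t ((Finite.equivFin _).symm Z)) ⊕ RealVars (q ((Finite.equivFin _).symm Z)))) =>
        Sum.elim (vb _) (vd _) i.2)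
    have hbM : ∀ Z, ((b Z).map σ).coords ⊆ eqPart M := by
      intro Z
      obtain ⟨i, rfl⟩ := (Finite.equivFin (F ∩ T : Set (Set (Tuple s)))).symm.surjective Z
      rintro _ ⟨j, rfl⟩
      rw [← hvb]
      exact ⟨_, fun k => hσM ⟨i, Sum.inl ⟨j, k⟩⟩, rfl⟩
    have hdM : ∀ Z, ((d Z).map σ).coords ⊆ eqPart M := by
      intro Z
      obtain ⟨i, rfl⟩ := (Finite.equivFin (F ∩ T : Set (Set (Tuple s)))).symm.surjective Z
      rintro _ ⟨j, rfl⟩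
      rw [← hvd]
      exact ⟨_, fun k => hσM ⟨i, Sum.inr ⟨j, k⟩⟩, rfl⟩
    have hXσ : Tuple.map σ '' ⋂₀ (F ∩ p.sets) = ⋂₀ (F ∩ p.sets) := by
      rw [hX, fiber_map hR₀, Tuple.map_eq_self_iff.2 (hσ.mono Set.subset_union_right)]
    -- one of the translated instances belongs to `p`
    obtain ⟨Z, hZp⟩ : ∃ Z, fiber (R Z) ((b Z).map σ) ∈ p.sets := by
      by_contra! hcon
      have hcompl : ∀ Z, (fiber (R Z) ((b Z).map σ))ᶜ ∈ p.sets := fun Z =>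
        (p.complete _ ⟨_, _, _, R Z, hbM Z, hR Z, rfl⟩).resolve_left (hcon Z)
      have hfin : (F ∩ p.sets ∪ Set.range fun Z => (fiber (R Z) ((b Z).map σ))ᶜ).Finite :=
        (hFf.subset Set.inter_subset_left).union (Set.finite_range _)
      obtain ⟨x, hx⟩ := p.consistent hfin.toFinset (by
        rw [Set.Finite.coe_toFinset]
        rintro Y (hY | ⟨Z, rfl⟩)
        · exact hY.2
        · exact hcompl Z)
      rw [Set.mem_iInter₂] at hx
      have hxX : x ∈ ⋂₀ (F ∩ p.sets) := fun Y hY => hx Y (by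
        rw [Set.Finite.mem_toFinset]
        exact Or.inl hY)
      rw [← hXσ, Tuple.mem_image_map] at hxX
      refine hemp ⟨x.map σ.symm, fun Y hY => ?_⟩
      rcases hF hY with hYp | hYT
      · exact hxX Y ⟨hY, hYp⟩
      · have hxY := hx (fiber (R ⟨Y, hY, hYT⟩) ((b ⟨Y, hY, hYT⟩).map σ))ᶜ (by
          rw [Set.Finite.mem_toFinset]
          exact Or.inr ⟨_, rfl⟩)
        rw [← fiber_map (hR _), Set.mem_compl_iff, Tuple.mem_image_map] at hxY
        rw [show Y = _ from hZ ⟨Y, hY, hYT⟩]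
        exact hxY
    have hne : (fiber (R Z) ((b Z).map σ)).Nonempty := by
      simpa using p.consistent {fiber (R Z) ((b Z).map σ)} (by simpa using hZp)
    rw [← fiber_map (hR Z)] at hne hZp
    obtain ⟨hw, hal⟩ := (hdiv Z).weaklyNormal_and_not_almostOver hN
      (hN.union_lt hCκ (hN.lt_of_finite (d Z).finite_coords)) (hR Z) (Set.image_nonempty.1 hne)
    have hCσ : Imag.map σ '' C = C := by
      have : Set.EqOn (Imag.map σ) id C := fun e he => hσ e (Or.inl he)
      rw [this.image_eq, Set.image_id]
    refine hal (hp _ hZp _ ?_ ?_ (hw.image σ)).of_image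
    · rw [Set.image_union, hCσ]
      exact Set.subset_union_left
    · rw [Set.image_union, hCσ, ← Tuple.coords_map]
      exact Set.union_subset hC (hdM Z))
  refine ⟨a, fun X hX => ha X (Or.inl hX), ?_⟩
  rintro ⟨n, t, b, R, hb, hR, hab, hdiv⟩
  exact ha _ (Or.inr ⟨n, t, b, R, hb, hR, rfl, hdiv⟩) hab.2

end MainDirections

end ThornForking

theorem proposition3p1 {L : FirstOrder.Language.{u, v}} {N : Type w} [L.Structure N] [Nonempty N]
    {κ : Cardinal.{w}} (hN : IsMonster L N κ)
    {m : ℕ} {s : Fin m → EqSort L N} (a : Tuple s)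
    (B C : Set (Imag L N)) (hCB : C ⊆ B) (hB : #B < κ) :
    ((tp a B).NotThornForks κ C ↔
      ∃ M : L.ElementarySubstructure N, #M < κ ∧ IsSaturated L M (max ℵ₀ (Order.succ #C)) ∧
        ∃ p : CompleteType (eqPart M) s, p.Extends (tp a B) ∧
          ∀ X ∈ p.sets, ∀ C' : Set (Imag L N), C ⊆ C' → C' ⊆ eqPart M →
            WeaklyNormal C' X → AlmostOver C' X) ∧
    (∀ (X : Set (Tuple s)) (C' : Set (Imag L N)), IsDefinable X → #C' < κ → WeaklyNormal C' X →
      (AlmostOver C' X ↔ ¬ Divides C' X) ∧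
      (¬ Forks C' X → AlmostOver C' X) ∧
      ((∀ Y : Set (Tuple s), DefinableOver C' Y → Y.Nonempty → ¬ Forks C' Y) →
        (AlmostOver C' X ↔ ¬ Forks C' X))) := by
  have hC : #C < κ := (Cardinal.mk_le_mk_of_subset hCB).trans_lt hB
  refine ⟨⟨fun h => ?_, ?_⟩, fun X C' hX hC' hw => ?_⟩
  · obtain ⟨y, hy⟩ := Reps.nonempty B
    obtain ⟨M, hM, hBM, hsat⟩ := hN.exists_saturated hC (Set.range y)
      (Cardinal.mk_range_le.trans_lt (hN.mk_paramVars_lt hB))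
    have hBM' : B ⊆ eqPart M := fun e he => ⟨_, fun i => hBM ⟨⟨⟨e, he⟩, i⟩, rfl⟩, hy ⟨e, he⟩⟩
    obtain ⟨a', ha', hdiv⟩ := h (eqPart M) hBM' (hN.mk_eqPart_lt hM)
    exact ⟨M, hM, hsat _ (max_le ((le_max_left _ _).trans (Order.le_succ _))
      (Order.succ_le_succ (le_max_right _ _))), tp a' (eqPart M), ha', fun X hX C' hCC' hC'M =>
        hN.almostOver_of_not_thornDivides hM hdiv hX hCC' hC'M⟩
  · rintro ⟨M, hM, hsat, p, ⟨hBM, hpB⟩, hp⟩ B' hBB' hB'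
    obtain ⟨a', ha', hdiv⟩ := hN.exists_not_thornDivides hM hC hsat (hCB.trans hBM) p hp hB'
    exact ⟨a', ⟨hBB', fun X hX => ⟨hX.1.mono hBB', ha' X (hpB hX)⟩⟩, hdiv⟩
  · have h1 : ¬ Divides C' X → AlmostOver C' X := fun h =>
      by_contra fun hal => h (hw.divides hN hC' hX hal)
    have h2 : ¬ Forks C' X → AlmostOver C' X := fun h => h1 fun hd => h (hd.forks hX)
    exact ⟨⟨fun h => h.not_divides hw.1, h1⟩, h2, fun hfork =>
      ⟨fun h => h.not_forks hN hC' hX hw.1 hfork, h2⟩⟩
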